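/- Let \(\gamma:\mathbb R\to\mathbb R^3\) be an analytic knot, that is, a real-analytic, \(\mathbb Z\)-periodic map with nowhere vanishing derivative which is injective on \([0,1)\). Let \(t_1<t_2<\dots<t_6<t_1+1\) be such that (a) the six points \(\gamma(t_1),\dots,\gamma(t_6)\) lie on a circle (of finite radius) in a plane \(P\subset\mathbb R^3\); (b) the six-tuple \((\gamma(t_1),\dots,\gamma(t_6))\), transported to \(S^3=\partial B^4\subset\mathbb R^4\subset\mathbb{RP}^4\) by inverse stereographic projection, belongs to the moduli space of triangular prisms: there are a point \(p\in\mathbb{RP}^4\setminus B^4\) and three distinct lines through \(p\), each meeting \(S^3\) in two points, such that these six points of intersection are the points \(x_1,\dots,x_6\) of the tuple, and two distinct points \(x_i,x_j\) are neither on the same one of the three lines nor in the same one of the two caps into which the polar hyperplane of \(p\) divides \(S^3\) if and only if \(i-j\equiv\pm1\pmod 6\); (c) at most two of the indices \(i\) are one-sided, where \(i\) is called one-sided if \(\gamma(u)\) stays in one of the two closed half-spaces bounded by \(P\) for all \(u\) near \(t_i\). Then for every \(\varepsilon>0\) there are \(t_1'<t_2'<\dots<t_6'<t_1'+1\) with \(|t_i'-t_i|<\varepsilon\)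 for all \(i\) such that the closed polygon obtained by cyclically joining \(\gamma(t_1'),\dots,\gamma(t_6')\) by line segments is a right-handed trefoil knot. -/

import Mathlib

open Set Filter Topology

/-- Euclidean 3-space with its standard (right-handed) orientation. -/
abbrev E3 : Type := EuclideanSpace ℝ (Fin 3)

/-- Euclidean 4-space; its unit sphere is the 3-sphere. -/
abbrev E4 : Type := EuclideanSpace ℝ (Fin 4)

/-! ### Analytic knots and six-tuples in parametric order -/

/-- A parametrized analytic knot in space: a real-analytic, `ℤ`-periodic map `ℝ → ℝ³` with nowhere
vanishing derivative that is injective on a period. -/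
structure IsAnalyticKnot (γ : ℝ → E3) : Prop where
  analytic : ∀ s, AnalyticAt ℝ γ s
  periodic : Function.Periodic γ 1
  deriv_ne_zero : ∀ s, deriv γ s ≠ 0
  injOn : Set.InjOn γ (Set.Ico 0 1)

/-- Six parameters `t₁ < t₂ < ⋯ < t₆ < t₁ + 1` (indexed from `0` to `5`). For such `t`, the tuples
`γ ∘ t` are the elements of `Q_γ`. -/
def InParametricOrder (t : Fin 6 → ℝ) : Prop :=
  StrictMono t ∧ t 5 < t 0 + 1

/-! ### The moduli space of triangular prisms in the 3-sphere -/

/-- Inverse stereographic projection `ℝ³ → S³ ⊆ ℝ⁴` from the north pole `(0, 0, 0, 1)`: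
`x ↦ (2x, ‖x‖² - 1) / (‖x‖² + 1)`. -/
noncomputable def invStereo (x : E3) : E4 :=
  (‖x‖ ^ 2 + 1)⁻¹ • !₂[2 * x 0, 2 * x 1, 2 * x 2, ‖x‖ ^ 2 - 1]

/-- A nonzero vector `p = (y, s)` of `ℝ⁴ × ℝ` stands for the point `[y : s]` of `ℝP⁴`; an affine
point `a` is `[a : 1]`. For `a ≠ b`, this says that `p` is on the projective line through `a`
and `b`. -/
def OnProjLine (p : E4 × ℝ) (a b : E4) : Prop :=
  p ∈ Submodule.span ℝ {((a, 1) : E4 × ℝ), ((b, 1) : E4 × ℝ)}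

/-- For `p = [y : s]` outside the closed unit ball, the polar hyperplane `{x | ⟪y, x⟫ = s}` of `p`
cuts the sphere `S³` into two caps: the points nearer to `p` and the points farther from `p` on the
lines through `p`. This says that `a` and `b` are in the same cap. -/
def InSameCap (p : E4 × ℝ) (a b : E4) : Prop :=
  0 < (inner ℝ p.1 a - p.2) * (inner ℝ p.1 b - p.2)

/-- The graph of the triangular prism with vertices `x 0, …, x 5` and apex `p`: two distinct
vertices are adjacent if they lie on the same line through `p` (vertical edges) or in the same cap
(edges of the two triangles). -/
def prismGraph (p : E4 × ℝ) (x : Fin 6 → E4) : SimpleGraph (Fin 6) :=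
  SimpleGraph.fromRel fun i j => OnProjLine p (x i) (x j) ∨ InSameCap p (x i) (x j)

/-- The moduli space `M` of triangular prisms, as a set of six-tuples of distinct points of `S³`:
there are a point `p` of `ℝP⁴` outside the closed unit ball and three lines through `p`, whose six
points of intersection with `S³` are `x 0, …, x 5`, labelled so that the complement of the prism
graph is the 6-cycle `0, 1, 2, 3, 4, 5`. Such a labelling puts opposite vertices of the cycle,
`i` and `i + 3`, on the same line. -/
def prismSpace : Set (Fin 6 → E4) :=
  {x | (∀ i, ‖x i‖ = 1) ∧ Function.Injective x ∧
    ∃ p : E4 × ℝ, p.2 ^ 2 < ‖p.1‖ ^ 2 ∧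
      (∀ i, OnProjLine p (x i) (x (i + 3))) ∧
      (prismGraph p x)ᶜ = SimpleGraph.cycleGraph 6}

/-! ### Circles, planes and one-sided points -/

/-- `x` is on the circle of centre `c` and radius `r` in the plane through `c` normal to `n`. -/
def OnCircle (n c : E3) (r : ℝ) (x : E3) : Prop :=
  inner ℝ n (x - c) = 0 ∧ dist x c = r

/-- The curve `γ` is one-sided at the parameter `s` in the plane through `c` normal to `n`: near `s`
it stays in one of the two closed half-spaces. -/
def IsOneSidedAt (γ : ℝ → E3) (n c : E3) (s : ℝ) : Prop :=
  (∀ᶠ u in 𝓝 s, 0 ≤ inner ℝ n (γ u - c)) ∨ (∀ᶠ u in 𝓝 s, inner ℝ n (γ u - c) ≤ 0)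

/-! ### Right-handed trefoils -/

/-- The closed hexagon with cyclically ordered vertices `v 0, …, v 5`. -/
def closedHexagon (v : Fin 6 → E3) : Set E3 :=
  ⋃ i, segment ℝ (v i) (v (i + 1))

/-- The closed hexagonal path through `v 0, …, v 5` has no self-intersections: the six half-open
edges `[v i, v (i + 1))` are parametrized injectively and pairwise disjoint. -/
def IsSimpleHexagon (v : Fin 6 → E3) : Prop :=
  Function.Injective fun q : Fin 6 × Set.Ico (0 : ℝ) 1 =>
    AffineMap.lineMap (v q.1) (v (q.1 + 1)) (q.2 : ℝ)

/-- Ambient isotopy of subsets of `ℝ³`. -/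
def AmbientIsotopic (K L : Set E3) : Prop :=
  ∃ H : unitInterval → (E3 ≃ₜ E3),
    Continuous (fun q : unitInterval × E3 => H q.1 q.2) ∧ (∀ x, H 0 x = x) ∧ H 1 '' K = L

/-- The model of the right-handed trefoil. Its projection to the first two coordinates, seen from
above, has exactly three crossings, at which
* the edge from `v 2` to `v 3` passes over the edge from `v 0` to `v 1`,
* the edge from `v 0` to `v 1` passes over the edge from `v 4` to `v 5`,
* the edge from `v 4` to `v 5` passes over the edge from `v 2` to `v 3`.

The diagram is alternating, and all three crossings are positive: the direction `a` of the upper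
edge and the direction `b` of the lower edge satisfy `a₀ b₁ - a₁ b₀ = 13 > 0` at each of them. -/
noncomputable def modelTrefoil : Fin 6 → E3 :=
  ![!₂[2, 0, 0], !₂[-1, 1, 1], !₂[-2, -2, 0], !₂[2, 1, 1], !₂[0, 2, 0], !₂[-1, -2, 1]]

/-- The closed polygon with vertices `v 0, …, v 5` is a right-handed trefoil knot. -/
def IsRightHandedTrefoil (v : Fin 6 → E3) : Prop :=
  IsSimpleHexagon v ∧ AmbientIsotopic (closedHexagon v) (closedHexagon modelTrefoil)

/-! ### Ambient isotopy is symmetric and transitive -/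

/-! Use affine coordinates `(q, r, h)` in which `P` is the plane `h = 0`. Read stereographically,
the prism condition says that the three chords joining opposite points of the circle meet in one
point `x`, possibly at infinity: `a i • y i + a (i + 3) • y (i + 3) = x`, with weights negative at
even and positive at odd indices. Keep the even points in `P` and lift the odd ones to heights
proportional to `1 / a i`; the lines through opposite vertices then still concur, over `x`. Since
`x` is outside the circle, its barycentric coordinates in the even triangle have mixed signs, and a
small change of the lifts resolves the triple point into the pattern of a trefoil
(`exists_interlocked_heights`).

That pattern consists of nine strict signs of oriented volumes. Adding an affine function of `(q,
r)` to the heights does not change these volumes, so the heights can be made zero at the at most two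
one-sided indices. At every other index `γ` crosses `P`, and the intermediate value theorem realizes
each small height at a nearby parameter. Scaling all heights by a small positive factor keeps the
signs, while `q` and `r` barely move.

Hexagons with these signs are right-handed trefoils: coordinates over the even triangle put them in
a connected family of simple hexagons containing the model (`ambientIsotopic_frameHexagon`), and
nearby simple hexagons are ambient isotopic because the displacement of the vertices extends to a
Lipschitz map of space with small constant. -/

namespace AmbientIsotopic

variable {K L M : Set E3}

theorem symm (h : AmbientIsotopic K L) : AmbientIsotopic L K := by
  obtain ⟨H, hc, h0, h1⟩ := h
  -- Undoing `H 1` first and then running `H` backwards needs only the one inverse `(H 1)⁻¹`, so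
  -- joint continuity of the inverses is not required.
  refine ⟨fun s => (H 1).symm.trans (H (unitInterval.symm s)), ?_, fun x => ?_, ?_⟩
  · exact hc.comp ((unitInterval.continuous_symm.comp continuous_fst).prodMk
      ((H 1).symm.continuous.comp continuous_snd))
  · simp
  · have : H 0 = Homeomorph.refl E3 := Homeomorph.ext h0
    rw [← h1, image_image]
    simp [this]

theorem trans (h : AmbientIsotopic K L) (h' : AmbientIsotopic L M) : AmbientIsotopic K M := by
  obtain ⟨H, hc, h0, h1⟩ := h
  obtain ⟨G, gc, g0, g1⟩ := h'
  refine ⟨fun s => (H s).trans (G s), ?_, fun x => ?_, ?_⟩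
  · exact gc.comp (continuous_fst.prodMk hc)
  · simp [h0, g0]
  · rw [← g1, ← h1, image_image]
    rfl

end AmbientIsotopic

/-- A continuous family of small Lipschitz perturbations of the identity is an ambient isotopy. -/
theorem ambientIsotopic_image_add {g : E3 → E3} {k : NNReal} (hg : LipschitzWith k g) (hk : k < 1)
    (K : Set E3) : AmbientIsotopic K ((fun x => x + g x) '' K) := by
  have hA : ∀ s : unitInterval, ApproximatesLinearOn (fun x => x + (s : ℝ) • g x)
      ((ContinuousLinearEquiv.refl ℝ E3 : E3 ≃L[ℝ] E3) : E3 →L[ℝ] E3) univ k := by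
    intro s x _ y _
    have h := hg.dist_le_mul x y
    rw [dist_eq_norm, dist_eq_norm] at h
    have : x + (s : ℝ) • g x - (y + (s : ℝ) • g y) -
        ((ContinuousLinearEquiv.refl ℝ E3 : E3 ≃L[ℝ] E3) : E3 →L[ℝ] E3) (x - y) =
        (s : ℝ) • (g x - g y) := by
      simp only [ContinuousLinearEquiv.coe_refl, ContinuousLinearMap.coe_id', id, smul_sub]
      abel
    rw [this, norm_smul, Real.norm_of_nonneg s.2.1]
    calc (s : ℝ) * ‖g x - g y‖ ≤ 1 * ‖g x - g y‖ := by gcongr; exact s.2.2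
      _ ≤ _ := by rw [one_mul]; exact h
  have hc : Subsingleton E3 ∨ k < ‖((ContinuousLinearEquiv.refl ℝ E3).symm : E3 →L[ℝ] E3)‖₊⁻¹ := by
    right
    have : ‖((ContinuousLinearEquiv.refl ℝ E3).symm : E3 →L[ℝ] E3)‖₊ = 1 := by
      have h : ‖ContinuousLinearMap.id ℝ E3‖ = 1 := ContinuousLinearMap.norm_id
      exact NNReal.eq h
    rw [this]; simpa using hk
  refine ⟨fun s => (hA s).toHomeomorph _ hc, ?_, fun x => ?_, ?_⟩
  · change Continuous fun q : unitInterval × E3 => q.2 + (q.1 : ℝ) • g q.2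
    have := hg.continuous
    fun_prop
  · change x + ((0 : unitInterval) : ℝ) • g x = x
    simp
  · change (fun x => x + ((1 : unitInterval) : ℝ) • g x) '' K = _
    simp

/-! ### Small perturbations of simple hexagons -/

/-- The point with parameter `s` on the edge from `v i` to `v (i + 1)`. -/
noncomputable def edgePoint (v : Fin 6 → E3) (i : Fin 6) (s : ℝ) : E3 :=
  AffineMap.lineMap (v i) (v (i + 1)) s

theorem edgePoint_eq (v : Fin 6 → E3) (i : Fin 6) (s : ℝ) :
    edgePoint v i s = (1 - s) • v i + s • v (i + 1) :=
  AffineMap.lineMap_apply_module _ _ _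

theorem continuous_edgePoint (v : Fin 6 → E3) (i : Fin 6) : Continuous (edgePoint v i) := by
  have : edgePoint v i = fun s => (1 - s) • v i + s • v (i + 1) := funext (edgePoint_eq v i)
  rw [this]; fun_prop

theorem edgePoint_one (v : Fin 6 → E3) (i : Fin 6) : edgePoint v i 1 = edgePoint v (i + 1) 0 := by
  simp [edgePoint]

theorem mem_closedHexagon {v : Fin 6 → E3} {x : E3} :
    x ∈ closedHexagon v ↔ ∃ i, ∃ s ∈ Icc (0 : ℝ) 1, edgePoint v i s = x := by
  simp only [closedHexagon, mem_iUnion, segment_eq_image_lineMap, mem_image]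
  rfl

/-- Closed edges meet only in the expected common vertices: the end of an edge is rewritten as the
start of the next one, which brings everything back to half-open edges. -/
theorem IsSimpleHexagon.edgePoint_inj {v : Fin 6 → E3} (hv : IsSimpleHexagon v) {i j : Fin 6}
    {s t : ℝ} (hs : s ∈ Icc (0 : ℝ) 1) (ht : t ∈ Icc (0 : ℝ) 1)
    (h : edgePoint v i s = edgePoint v j t) :
    (i = j ∧ s = t) ∨ (j = i + 1 ∧ s = 1 ∧ t = 0) ∨ (i = j + 1 ∧ t = 1 ∧ s = 0) := by
  have key : ∀ {i j : Fin 6} {s t : ℝ}, s ∈ Ico (0 : ℝ) 1 → t ∈ Ico (0 : ℝ) 1 →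
      edgePoint v i s = edgePoint v j t → i = j ∧ s = t := by
    intro i j s t hs ht h
    have := @hv (i, ⟨s, hs⟩) (j, ⟨t, ht⟩) h
    simpa using this
  have h0 : (0 : ℝ) ∈ Ico (0 : ℝ) 1 := by simp
  rcases hs.2.eq_or_lt with rfl | hs1 <;> rcases ht.2.eq_or_lt with rfl | ht1
  · rw [edgePoint_one, edgePoint_one] at h
    left; simpa using (key h0 h0 h).1
  · rw [edgePoint_one] at h
    obtain ⟨h1, h2⟩ := key h0 ⟨ht.1, ht1⟩ h
    exact Or.inr (Or.inl ⟨h1.symm, rfl, h2.symm⟩)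
  · rw [edgePoint_one] at h
    obtain ⟨h1, h2⟩ := key ⟨hs.1, hs1⟩ h0 h
    exact Or.inr (Or.inr ⟨h1, rfl, h2⟩)
  · exact Or.inl (key ⟨hs.1, hs1⟩ ⟨ht.1, ht1⟩ h)

/-- If `x • a = y • b` has no solution on the simplex, then `‖x • a - y • b‖` controls `x + y`. -/
theorem exists_mul_add_le_norm_sub {E : Type*} [NormedAddCommGroup E] [NormedSpace ℝ E] {a b : E}
    (h : ∀ τ ∈ Icc (0 : ℝ) 1, (1 - τ) • a ≠ τ • b) :
    ∃ c > 0, ∀ x y : ℝ, 0 ≤ x → 0 ≤ y → c * (x + y) ≤ ‖x • a - y • b‖ := by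
  obtain ⟨τ, hτ, hmin⟩ := (isCompact_Icc (a := (0 : ℝ)) (b := 1)).exists_isMinOn
    ⟨0, by simp⟩ (f := fun τ => ‖(1 - τ) • a - τ • b‖) (by fun_prop)
  refine ⟨_, norm_pos_iff.2 (sub_ne_zero.2 (h τ hτ)), fun x y hx hy => ?_⟩
  rcases (add_nonneg hx hy).eq_or_lt with h0 | h0
  · rw [← h0, mul_zero]; exact norm_nonneg _
  have hm : ‖(1 - τ) • a - τ • b‖ ≤ ‖(1 - y / (x + y)) • a - (y / (x + y)) • b‖ :=
    hmin (show y / (x + y) ∈ Icc (0 : ℝ) 1 from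
      ⟨by positivity, (div_le_one h0).2 (by linarith)⟩)
  have e : x • a - y • b = (x + y) • ((1 - y / (x + y)) • a - (y / (x + y)) • b) := by
    rw [smul_sub, smul_smul, smul_smul]
    congr 2 <;> field_simp
    ring
  rw [e, norm_smul, Real.norm_of_nonneg h0.le, mul_comm]
  gcongr

/-- Two disjoint compact arcs are at positive distance. -/
theorem exists_pos_le_norm_sub {E : Type*} [NormedAddCommGroup E] {f g : ℝ → E}
    (hf : Continuous f) (hg : Continuous g)
    (h : ∀ s ∈ Icc (0 : ℝ) 1, ∀ t ∈ Icc (0 : ℝ) 1, f s ≠ g t) :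
    ∃ m > 0, ∀ s ∈ Icc (0 : ℝ) 1, ∀ t ∈ Icc (0 : ℝ) 1, m ≤ ‖f s - g t‖ := by
  have hF : Continuous fun q : ℝ × ℝ => ‖f q.1 - g q.2‖ := by fun_prop
  obtain ⟨q, hq, hmin⟩ :=
    ((isCompact_Icc (a := (0 : ℝ)) (b := 1)).prod
      (isCompact_Icc (a := (0 : ℝ)) (b := 1))).exists_isMinOn ⟨(0, 0), by simp⟩ hF.continuousOn
  refine ⟨_, norm_pos_iff.2 (sub_ne_zero.2 (h q.1 hq.1 q.2 hq.2)), fun s hs t ht => ?_⟩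
  exact isMinOn_iff.1 hmin (s, t) ⟨hs, ht⟩

/-- Displacements of the vertices of the hexagon `v`, extended linearly to its edges, are Lipschitz
on the union of the edges `i` and `j`. -/
def ControlsDisplacement (v : Fin 6 → E3) (i j : Fin 6) : Prop :=
  ∃ c > 0, ∀ (d : Fin 6 → E3) (M : ℝ), (∀ i, ‖d i‖ ≤ M) → ∀ s ∈ Icc (0 : ℝ) 1,
    ∀ t ∈ Icc (0 : ℝ) 1, c * ‖edgePoint d i s - edgePoint d j t‖ ≤
      M * ‖edgePoint v i s - edgePoint v j t‖

theorem ControlsDisplacement.symm {v : Fin 6 → E3} {i j : Fin 6} (h : ControlsDisplacement v i j) :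
    ControlsDisplacement v j i := by
  obtain ⟨c, hc, h⟩ := h
  refine ⟨c, hc, fun d M hd s hs t ht => ?_⟩
  rw [norm_sub_rev, norm_sub_rev (edgePoint v j s)]
  exact h d M hd t ht s hs

namespace IsSimpleHexagon

variable {v : Fin 6 → E3}

theorem controlsDisplacement_self (hv : IsSimpleHexagon v) (i : Fin 6) :
    ControlsDisplacement v i i := by
  have hne : v i - v (i + 1) ≠ 0 := by
    intro h
    have := hv.edgePoint_inj (i := i) (j := i) (s := 0) (t := 1) (by simp) (by simp)
      (by simp [edgePoint, sub_eq_zero.1 h])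
    simp at this
  refine ⟨‖v i - v (i + 1)‖ / 2, by positivity, fun d M hd s _ t _ => ?_⟩
  have e : ∀ w : Fin 6 → E3, edgePoint w i s - edgePoint w i t = (t - s) • (w i - w (i + 1)) := by
    intro w; simp only [edgePoint_eq]; module
  have h2 : ‖d i - d (i + 1)‖ ≤ M + M := (norm_sub_le _ _).trans (add_le_add (hd _) (hd _))
  rw [e, e, norm_smul, norm_smul]
  have : ‖v i - v (i + 1)‖ / 2 * (‖t - s‖ * ‖d i - d (i + 1)‖) ≤
      ‖v i - v (i + 1)‖ / 2 * (‖t - s‖ * (M + M)) := by gcongr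
  linarith

/-- Seen from the common vertex, differences of points of the two edges are `(1 - s) • a - t • b`.
By simplicity the edges do not leave along the same ray, so the norm dominates `(1 - s) + t`, and
the displacement is at most `2 * M` times this sum. -/
theorem controlsDisplacement_succ (hv : IsSimpleHexagon v) (i : Fin 6) :
    ControlsDisplacement v i (i + 1) := by
  have e : ∀ (w : Fin 6 → E3) (s t : ℝ), edgePoint w i s - edgePoint w (i + 1) t =
      (1 - s) • (w i - w (i + 1)) - t • (w (i + 1 + 1) - w (i + 1)) := by
    intro w s t; simp only [edgePoint_eq]; module
  have h1 : ∀ i : Fin 6, i ≠ i + 1 := by decide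
  have h2 : ∀ i : Fin 6, i ≠ i + 1 + 1 := by decide
  obtain ⟨c, hc, hcv⟩ := exists_mul_add_le_norm_sub (a := v i - v (i + 1))
    (b := v (i + 1 + 1) - v (i + 1)) (by
      intro τ hτ h
      have h' := e v τ τ
      rw [h, sub_self, sub_eq_zero] at h'
      rcases hv.edgePoint_inj hτ hτ h' with h | h | h
      · exact h1 i h.1
      · linarith [h.2.1, h.2.2]
      · exact h2 i h.1)
  refine ⟨c / 2, by positivity, fun d M hd s hs t ht => ?_⟩
  have hM : 0 ≤ M := (norm_nonneg _).trans (hd 0)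
  have h1 : ‖d i - d (i + 1)‖ ≤ M + M := (norm_sub_le _ _).trans (add_le_add (hd _) (hd _))
  have h2 : ‖d (i + 1 + 1) - d (i + 1)‖ ≤ M + M :=
    (norm_sub_le _ _).trans (add_le_add (hd _) (hd _))
  have hs' : 0 ≤ 1 - s := by linarith [hs.2]
  have ht' := ht.1
  rw [e, e]
  have h3 : ‖(1 - s) • (d i - d (i + 1)) - t • (d (i + 1 + 1) - d (i + 1))‖ ≤
      (1 - s) * (M + M) + t * (M + M) := by
    refine (norm_sub_le _ _).trans ?_
    rw [norm_smul, norm_smul, Real.norm_of_nonneg hs', Real.norm_of_nonneg ht']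
    gcongr
  calc _ ≤ c / 2 * ((1 - s) * (M + M) + t * (M + M)) := by gcongr
    _ = M * (c * ((1 - s) + t)) := by ring
    _ ≤ _ := mul_le_mul_of_nonneg_left (hcv (1 - s) t hs' ht') hM

theorem controlsDisplacement_of_apart (hv : IsSimpleHexagon v) {i j : Fin 6} (h1 : i ≠ j)
    (h2 : j ≠ i + 1) (h3 : i ≠ j + 1) : ControlsDisplacement v i j := by
  obtain ⟨m, hpos, hmin⟩ := exists_pos_le_norm_sub (continuous_edgePoint v i)
    (continuous_edgePoint v j) (fun s hs t ht h => by
      rcases hv.edgePoint_inj hs ht h with h | h | h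
      · exact h1 h.1
      · exact h2 h.1
      · exact h3 h.1)
  refine ⟨_, half_pos hpos, fun d M hd s hs t ht => ?_⟩
  have hM : 0 ≤ M := (norm_nonneg _).trans (hd 0)
  have bound : ∀ i, ∀ s ∈ Icc (0 : ℝ) 1, ‖edgePoint d i s‖ ≤ M := by
    intro i s hs
    have hs' : 0 ≤ 1 - s := by linarith [hs.2]
    rw [edgePoint_eq]
    refine (norm_add_le _ _).trans ?_
    rw [norm_smul, norm_smul, Real.norm_of_nonneg hs', Real.norm_of_nonneg hs.1]
    have h4 := mul_le_mul_of_nonneg_left (hd i) hs'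
    have h5 := mul_le_mul_of_nonneg_left (hd (i + 1)) hs.1
    linarith
  have hb : ‖edgePoint d i s - edgePoint d j t‖ ≤ M + M :=
    (norm_sub_le _ _).trans (add_le_add (bound i s hs) (bound j t ht))
  have h4 := mul_le_mul_of_nonneg_left hb (half_pos hpos).le
  have h5 := mul_le_mul_of_nonneg_left (hmin s hs t ht) hM
  linarith

theorem controlsDisplacement (hv : IsSimpleHexagon v) (i j : Fin 6) :
    ControlsDisplacement v i j := by
  by_cases h1 : i = j
  · subst h1; exact hv.controlsDisplacement_self _
  by_cases h2 : j = i + 1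
  · subst h2; exact hv.controlsDisplacement_succ i
  by_cases h3 : i = j + 1
  · subst h3; exact (hv.controlsDisplacement_succ j).symm
  · exact hv.controlsDisplacement_of_apart h1 h2 h3

theorem exists_mul_norm_sub_le (hv : IsSimpleHexagon v) :
    ∃ c > 0, ∀ (d : Fin 6 → E3) (M : ℝ), (∀ i, ‖d i‖ ≤ M) → ∀ i j, ∀ s ∈ Icc (0 : ℝ) 1,
      ∀ t ∈ Icc (0 : ℝ) 1, c * ‖edgePoint d i s - edgePoint d j t‖ ≤
        M * ‖edgePoint v i s - edgePoint v j t‖ := by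
  choose c hc h using hv.controlsDisplacement
  obtain ⟨q, hq⟩ := Finite.exists_min fun q : Fin 6 × Fin 6 => c q.1 q.2
  refine ⟨c q.1 q.2, hc _ _, fun d M hd i j s hs t ht => ?_⟩
  exact (mul_le_mul_of_nonneg_right (hq (i, j)) (norm_nonneg _)).trans (h i j d M hd s hs t ht)

end IsSimpleHexagon

/-- Hexagons close to a simple hexagon are ambient isotopic to it. -/
theorem IsSimpleHexagon.eventually_ambientIsotopic {v : Fin 6 → E3} (hv : IsSimpleHexagon v) :
    ∀ᶠ w in 𝓝 v, AmbientIsotopic (closedHexagon v) (closedHexagon w) := by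
  obtain ⟨c, hc, h⟩ := hv.exists_mul_norm_sub_le
  set C : NNReal := lipschitzExtensionConstant E3 with hC
  have hCpos : 0 < C := lipschitzExtensionConstant_pos E3
  -- This radius makes the displacement `1 / (2 * C)`-Lipschitz on the hexagon, so that its
  -- extension to space has constant `1 / 2`.
  have hδ : 0 < c / (2 * C) := by positivity
  filter_upwards [Metric.ball_mem_nhds v hδ] with w hw
  have hd : ∀ i, ‖(w - v) i‖ ≤ c / (2 * C) := by
    intro i
    rw [Pi.sub_apply, ← dist_eq_norm]
    exact (dist_le_pi_dist w v i).trans (Metric.mem_ball.1 hw).le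
  have hL := h (w - v) _ hd
  have hwd : ∀ i j, ∀ s ∈ Icc (0 : ℝ) 1, ∀ t ∈ Icc (0 : ℝ) 1,
      edgePoint v i s = edgePoint v j t → edgePoint (w - v) i s = edgePoint (w - v) j t := by
    intro i j s hs t ht e
    have := hL i j s hs t ht
    rw [e, sub_self, norm_zero, mul_zero] at this
    have h0 : ‖edgePoint (w - v) i s - edgePoint (w - v) j t‖ ≤ 0 := by
      by_contra hcon
      push Not at hcon
      nlinarith
    exact sub_eq_zero.1 (norm_le_zero_iff.1 h0)
  -- The displacement depends only on the point, not on the edge chosen through it; the value `0`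
  -- off the hexagon plays no role.
  have hex : ∀ x : E3, ∃ y : E3, ∀ i, ∀ s ∈ Icc (0 : ℝ) 1, edgePoint v i s = x →
      edgePoint (w - v) i s = y := by
    intro x
    by_cases hx : ∃ i, ∃ s ∈ Icc (0 : ℝ) 1, edgePoint v i s = x
    · obtain ⟨i, s, hs, e⟩ := hx
      exact ⟨_, fun j t ht e' => hwd j i t ht s hs (e'.trans e.symm)⟩
    · exact ⟨0, fun i s hs e => (hx ⟨i, s, hs, e⟩).elim⟩
  choose f hf using hex
  have hlip : LipschitzOnWith (1 / (2 * C)) f (closedHexagon v) := by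
    refine LipschitzOnWith.of_dist_le_mul fun x hx y hy => ?_
    obtain ⟨i, s, hs, rfl⟩ := mem_closedHexagon.1 hx
    obtain ⟨j, t, ht, rfl⟩ := mem_closedHexagon.1 hy
    rw [← hf _ i s hs rfl, ← hf _ j t ht rfl, dist_eq_norm, dist_eq_norm]
    have := hL i j s hs t ht
    have e : c / (2 * (C : ℝ)) = c * (1 / (2 * C)) := by ring
    rw [e, mul_assoc] at this
    simpa using le_of_mul_le_mul_left this hc
  obtain ⟨g, hg, hgf⟩ := hlip.extend_finite_dimension
  have hk : lipschitzExtensionConstant E3 * (1 / (2 * C)) < 1 := by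
    have : lipschitzExtensionConstant E3 * (1 / (2 * C)) = 1 / 2 := by
      rw [← hC]; field_simp
    rw [this]; exact NNReal.half_lt_self one_ne_zero
  have himg : (fun x => x + g x) '' closedHexagon v = closedHexagon w := by
    have hpt : ∀ i, ∀ s ∈ Icc (0 : ℝ) 1, edgePoint v i s + g (edgePoint v i s) = edgePoint w i s := by
      intro i s hs
      rw [← hgf (mem_closedHexagon.2 ⟨i, s, hs, rfl⟩), ← hf _ i s hs rfl]
      simp only [edgePoint_eq, Pi.sub_apply]
      module
    ext x
    simp only [mem_image, mem_closedHexagon]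
    constructor
    · rintro ⟨_, ⟨i, s, hs, rfl⟩, rfl⟩
      exact ⟨i, s, hs, (hpt i s hs).symm⟩
    · rintro ⟨i, s, hs, rfl⟩
      exact ⟨_, ⟨i, s, hs, rfl⟩, hpt i s hs⟩
  rw [← himg]
  exact ambientIsotopic_image_add hg hk _

/-- Hexagons in a connected set of simple hexagons are ambient isotopic. -/
theorem ambientIsotopic_of_isPreconnected {S : Set (Fin 6 → E3)} (hS : IsPreconnected S)
    (hsimple : ∀ v ∈ S, IsSimpleHexagon v) {v w : Fin 6 → E3} (hv : v ∈ S) (hw : w ∈ S) :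
    AmbientIsotopic (closedHexagon v) (closedHexagon w) :=
  hS.induction₂' (fun v w => AmbientIsotopic (closedHexagon v) (closedHexagon w))
    (fun v hv => ((hsimple v hv).eventually_ambientIsotopic.filter_mono nhdsWithin_le_nhds).mono
      fun _ h => ⟨h, h.symm⟩)
    (fun _ _ _ _ _ _ h h' => h.trans h') hv hw

/-! ### Orientations of quadruples of points -/

/-- The determinant of three vectors of `ℝ³`. -/
def tripleDet (x y z : E3) : ℝ :=
  x 0 * (y 1 * z 2 - y 2 * z 1) - x 1 * (y 0 * z 2 - y 2 * z 0) + x 2 * (y 0 * z 1 - y 1 * z 0)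

/-- Six times the oriented volume of the tetrahedron with vertices `x`, `y`, `z`, `w`. -/
def orient (x y z w : E3) : ℝ :=
  tripleDet (y - x) (z - x) (w - x)

theorem tripleDet_combination (a b u : E3) (x y z : Fin 3 → ℝ) :
    tripleDet (x 0 • a + x 1 • b + x 2 • u) (y 0 • a + y 1 • b + y 2 • u)
      (z 0 • a + z 1 • b + z 2 • u) = tripleDet a b u * (x 0 * (y 1 * z 2 - y 2 * z 1) -
        x 1 * (y 0 * z 2 - y 2 * z 0) + x 2 * (y 0 * z 1 - y 1 * z 0)) := by
  simp only [tripleDet, PiLp.add_apply, PiLp.smul_apply, smul_eq_mul]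
  ring

/-- The oriented volume spanned by four points given in affine coordinates `(q, r, h)`. -/
def coordDet (q r h : Fin 6 → ℝ) (i j k l : Fin 6) : ℝ :=
  (q j - q i) * ((r k - r i) * (h l - h i) - (h k - h i) * (r l - r i)) -
    (r j - r i) * ((q k - q i) * (h l - h i) - (h k - h i) * (q l - q i)) +
    (h j - h i) * ((q k - q i) * (r l - r i) - (r k - r i) * (q l - q i))

theorem orient_eq_mul_coordDet {o a b u : E3} {v : Fin 6 → E3} {q r h : Fin 6 → ℝ}
    (hv : ∀ i, v i = o + q i • a + r i • b + h i • u) (i j k l : Fin 6) :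
    orient (v i) (v j) (v k) (v l) = tripleDet a b u * coordDet q r h i j k l := by
  have key : ∀ m, v m - v i = (![q m - q i, r m - r i, h m - h i] : Fin 3 → ℝ) 0 • a +
      (![q m - q i, r m - r i, h m - h i] : Fin 3 → ℝ) 1 • b +
      (![q m - q i, r m - r i, h m - h i] : Fin 3 → ℝ) 2 • u := by
    intro m
    rw [hv m, hv i]
    simp only [Matrix.cons_val]
    module
  rw [orient, key, key, key, tripleDet_combination]
  simp [coordDet]

/-- Nine orientation conditions on the vertices of a hexagon. They say that the vertices of odd
index lie on the same side of the triangle `v 0, v 2, v 4`, and that the edges pierce the triangles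
`v 0, v 1, v 2`, `v 2, v 3, v 4`, `v 4, v 5, v 0` as in a right-handed trefoil. -/
structure IsPositivelyInterlocked (D : Fin 6 → Fin 6 → Fin 6 → Fin 6 → ℝ) : Prop where
  above : D 0 2 4 1 < 0 ∧ D 0 2 4 3 < 0 ∧ D 0 2 4 5 < 0
  fst : D 2 4 3 5 < 0 ∧ D 2 4 5 1 < 0
  snd : D 4 0 5 1 < 0 ∧ D 4 0 1 3 < 0
  trd : D 0 2 1 3 < 0 ∧ D 0 2 3 5 < 0

/-! ### Interlocked hexagons over a triangle -/

/-- The opposite of the cross product. -/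
noncomputable def normal (a b : E3) : E3 :=
  !₂[a 2 * b 1 - a 1 * b 2, a 0 * b 2 - a 2 * b 0, a 1 * b 0 - a 0 * b 1]

theorem normal_sq_pos {a b : E3} (h : normal a b ≠ 0) :
    0 < normal a b 0 ^ 2 + normal a b 1 ^ 2 + normal a b 2 ^ 2 := by
  have h' : 0 < ‖normal a b‖ ^ 2 := by positivity
  simpa [EuclideanSpace.norm_sq_eq, Fin.sum_univ_three] using h'

theorem tripleDet_normal (a b : E3) :
    tripleDet a b (normal a b) = -(normal a b 0 ^ 2 + normal a b 1 ^ 2 + normal a b 2 ^ 2) := by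
  simp [tripleDet, normal]; ring

/-- Cramer's rule without division. -/
theorem eq_combination (a b x : E3) : tripleDet a b (normal a b) • x =
    tripleDet x b (normal a b) • a + tripleDet a x (normal a b) • b + tripleDet a b x • normal a b := by
  ext k
  fin_cases k <;> simp [tripleDet, normal] <;> ring

theorem combination_injective {a b : E3} (h : normal a b ≠ 0) {q r z q' r' z' : ℝ}
    (e : q • a + r • b + z • normal a b = q' • a + r' • b + z' • normal a b) :
    q = q' ∧ r = r' ∧ z = z' := by
  have hN := normal_sq_pos h
  have hD : tripleDet a b (normal a b) ≠ 0 := by rw [tripleDet_normal]; linarith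
  have e0 : (q - q') • a + (r - r') • b + (z - z') • normal a b = 0 := by
    rw [← sub_eq_zero.2 e]; module
  have h0 : ∀ x y : E3, tripleDet 0 x y = 0 ∧ tripleDet x 0 y = 0 ∧ tripleDet x y 0 = 0 := by
    intro x y; simp [tripleDet]
  have h1 : (q - q') * tripleDet a b (normal a b) = 0 := by
    rw [← (h0 b (normal a b)).1, ← e0]
    simp only [tripleDet, PiLp.add_apply, PiLp.smul_apply, smul_eq_mul]; ring
  have h2 : (r - r') * tripleDet a b (normal a b) = 0 := by
    rw [← (h0 a (normal a b)).2.1, ← e0]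
    simp only [tripleDet, PiLp.add_apply, PiLp.smul_apply, smul_eq_mul]; ring
  have h3 : (z - z') * tripleDet a b (normal a b) = 0 := by
    rw [← (h0 a b).2.2, ← e0]
    simp only [tripleDet, PiLp.add_apply, PiLp.smul_apply, smul_eq_mul]; ring
  simpa [hD, sub_eq_zero] using And.intro h1 (And.intro h2 h3)

/-- The point above the triangle `o, o + a, o + b` whose homogeneous barycentric coordinates are
`w`; its height is the inverse of the sum of the coordinates. -/
noncomputable def apexPoint (o a b : E3) (w : Fin 3 → ℝ) : E3 :=
  o + (w 0 + w 1 + w 2)⁻¹ • (w 1 • a + w 2 • b + normal a b)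

/-- The hexagon with even vertices `o, o + a, o + b` and odd vertices above their plane. -/
noncomputable def frameHexagon (o a b : E3) (w : Fin 3 → Fin 3 → ℝ) : Fin 6 → E3 :=
  ![o, apexPoint o a b (w 0), o + a, apexPoint o a b (w 1), o + b, apexPoint o a b (w 2)]

/-- The interlocking conditions in homogeneous coordinates. -/
def interlockedWeights : Set (Fin 3 → Fin 3 → ℝ) :=
  {w | (∀ i, 0 < w i 0 + w i 1 + w i 2) ∧ (w 2 0 < w 1 0 ∧ w 0 0 < w 2 0) ∧
    (w 0 1 < w 2 1 ∧ w 1 1 < w 0 1) ∧ (w 1 2 < w 0 2 ∧ w 2 2 < w 1 2)}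

/-- Dividing barycentric coordinates by the height, as `apexPoint` does, turns the determinants of
the interlocking conditions into differences of weights. All conditions are thus strict linear
inequalities. -/
theorem convex_interlockedWeights : Convex ℝ interlockedWeights := by
  have key : ∀ {x y x' y' α β : ℝ}, x < y → x' < y' → 0 ≤ α → 0 ≤ β → α + β = 1 →
      α * x + β * x' < α * y + β * y' := by
    intro x y x' y' α β h h' hα hβ hs
    rcases hα.eq_or_lt with rfl | hα
    · have : β = 1 := by linarith
      subst this; linarith
    · have := mul_lt_mul_of_pos_left h hα
      have := mul_le_mul_of_nonneg_left h'.le hβ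
      linarith
  rintro w ⟨h1, ⟨h2, h3⟩, ⟨h4, h5⟩, h6, h7⟩ w' ⟨k1, ⟨k2, k3⟩, ⟨k4, k5⟩, k6, k7⟩ α β hα hβ hs
  refine ⟨fun i => ?_, ⟨?_, ?_⟩, ⟨?_, ?_⟩, ?_, ?_⟩
  · have := key (h1 i) (k1 i) hα hβ hs
    simp only [Pi.add_apply, Pi.smul_apply, smul_eq_mul]
    linarith
  · exact key h2 k2 hα hβ hs
  · exact key h3 k3 hα hβ hs
  · exact key h4 k4 hα hβ hs
  · exact key h5 k5 hα hβ hs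
  · exact key h6 k6 hα hβ hs
  · exact key h7 k7 hα hβ hs

/-- The even vertex of an edge. -/
def evenEnd : Fin 6 → Fin 3 := ![0, 1, 1, 2, 2, 0]

/-- The odd vertex of an edge. -/
def oddEnd : Fin 6 → Fin 3 := ![0, 0, 1, 1, 2, 2]

/-- The parameter on an edge running from its even to its odd vertex. -/
def oddParam (i : Fin 6) (s : ℝ) : ℝ := if i.val % 2 = 0 then s else 1 - s

theorem edgePoint_frameHexagon (o a b : E3) {w : Fin 3 → Fin 3 → ℝ} (i : Fin 6) (s : ℝ) :
    edgePoint (frameHexagon o a b w) i s = o +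
      ((((1 - oddParam i s) * if evenEnd i = 1 then 1 else 0) + oddParam i s *
        (w (oddEnd i) 0 + w (oddEnd i) 1 + w (oddEnd i) 2)⁻¹ * w (oddEnd i) 1) • a +
      (((1 - oddParam i s) * if evenEnd i = 2 then 1 else 0) + oddParam i s *
        (w (oddEnd i) 0 + w (oddEnd i) 1 + w (oddEnd i) 2)⁻¹ * w (oddEnd i) 2) • b +
      (oddParam i s * (w (oddEnd i) 0 + w (oddEnd i) 1 + w (oddEnd i) 2)⁻¹) • normal a b) := by
  rw [edgePoint_eq]
  fin_cases i <;> simp [frameHexagon, apexPoint, evenEnd, oddEnd, oddParam] <;> module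

/-- In each of the three coordinates the weights of the three odd vertices are distinct. If points
of two edges coincide off the base plane, compare them in a coordinate that vanishes at both even
ends: the odd ends must agree. On the base plane only the even vertices remain. -/
theorem isSimpleHexagon_frameHexagon (o : E3) {a b : E3} (hab : normal a b ≠ 0)
    {w : Fin 3 → Fin 3 → ℝ} (hw : w ∈ interlockedWeights) :
    IsSimpleHexagon (frameHexagon o a b w) := by
  obtain ⟨hpos, ⟨h1, h2⟩, ⟨h3, h4⟩, h5, h6⟩ := hw
  have hinj : ∀ i j k, i ≠ j → w i k ≠ w j k := by
    intro i j k
    fin_cases i <;> fin_cases j <;> fin_cases k <;> simp <;> intro h <;> linarith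
  rintro ⟨i, s, hs⟩ ⟨j, t, ht⟩ h
  change edgePoint _ i s = edgePoint _ j t at h
  rw [edgePoint_frameHexagon, edgePoint_frameHexagon] at h
  obtain ⟨hq, hr, hz⟩ := combination_injective hab (add_left_cancel h)
  have range : ∀ i s, s ∈ Ico (0 : ℝ) 1 → 0 ≤ oddParam i s := by
    intro i s hs
    unfold oddParam; split_ifs
    · exact hs.1
    · linarith [hs.2]
  have zero : ∀ i s, s ∈ Ico (0 : ℝ) 1 → oddParam i s = 0 → i.val % 2 = 0 ∧ s = 0 := by
    intro i s hs h
    unfold oddParam at h; split_ifs at h with h'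
    · exact ⟨h', h⟩
    · linarith [hs.2]
  have one : ∀ i s, s ∈ Ico (0 : ℝ) 1 → oddParam i s = 1 → i.val % 2 ≠ 0 ∧ s = 0 := by
    intro i s hs h
    unfold oddParam at h; split_ifs at h with h'
    · linarith [hs.2]
    · exact ⟨h', by linarith⟩
  have same : ∀ i j : Fin 6, evenEnd i = evenEnd j → oddEnd i = oddEnd j → i = j := by decide
  have sameEven : ∀ i j : Fin 6, i.val % 2 = 0 → j.val % 2 = 0 → evenEnd i = evenEnd j → i = j := by
    decide
  have sameOdd : ∀ i j : Fin 6, i.val % 2 ≠ 0 → j.val % 2 ≠ 0 → oddEnd i = oddEnd j → i = j := by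
    decide
  have third : ∀ k l : Fin 3, ∃ m, m ≠ k ∧ m ≠ l := by decide
  suffices i = j ∧ s = t by
    obtain ⟨rfl, rfl⟩ := this; rfl
  have hτ := range i s hs
  have hτ' := range j t ht
  have hzi := zero i s hs
  have hzj := zero j t ht
  have hoi := one i s hs
  have hoj := one j t ht
  have hst : i = j → oddParam i s = oddParam j t → s = t := by
    rintro rfl h
    unfold oddParam at h; split_ifs at h <;> linarith
  have hS := hpos (oddEnd i)
  have hS' := hpos (oddEnd j)
  generalize oddParam i s = τ at *
  generalize oddParam j t = τ' at *
  set S := w (oddEnd i) 0 + w (oddEnd i) 1 + w (oddEnd i) 2 with hSdef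
  set S' := w (oddEnd j) 0 + w (oddEnd j) 1 + w (oddEnd j) 2 with hSdef'
  set σ := τ * S⁻¹ with hσ
  rw [← hz] at hq hr
  have hτσ : τ = σ * S := by rw [hσ]; field_simp
  have hτσ' : τ' = σ * S' := by rw [hz]; field_simp
  -- Coordinates `1` and `2` are `hq` and `hr`; coordinate `0` follows because the barycentric
  -- coordinates sum to `1` on both sides.
  have hall : ∀ k, ((1 - τ) * if evenEnd i = k then 1 else 0) + σ * w (oddEnd i) k =
      ((1 - τ') * if evenEnd j = k then 1 else 0) + σ * w (oddEnd j) k := by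
    have sum : ∀ e : Fin 3, (if e = 0 then (1 : ℝ) else 0) =
        1 - (if e = 1 then 1 else 0) - (if e = 2 then 1 else 0) := by
      intro e; fin_cases e <;> simp
    intro k
    fin_cases k
    · have e1 : σ * w (oddEnd i) 0 = τ - σ * w (oddEnd i) 1 - σ * w (oddEnd i) 2 := by
        rw [hτσ, hSdef]; ring
      have e2 : σ * w (oddEnd j) 0 = τ' - σ * w (oddEnd j) 1 - σ * w (oddEnd j) 2 := by
        rw [hτσ', hSdef']; ring
      simp only [Fin.zero_eta, sum, e1, e2]
      linear_combination -hq - hr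
    · exact hq
    · exact hr
  rcases (show 0 ≤ σ by positivity).eq_or_lt with h0 | h0
  · have t0 : τ = 0 := by rw [hτσ, ← h0, zero_mul]
    have t0' : τ' = 0 := by rw [hτσ', ← h0, zero_mul]
    have he := hall (evenEnd i)
    rw [t0, t0', ← h0] at he
    have he' : evenEnd j = evenEnd i := by
      by_contra hne
      simp [hne] at he
    exact ⟨sameEven i j (hzi t0).1 (hzj t0').1 he'.symm, (hzi t0).2.trans (hzj t0').2.symm⟩
  · have ho : oddEnd i = oddEnd j := by
      by_contra hne
      obtain ⟨k, hk, hk'⟩ := third (evenEnd i) (evenEnd j)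
      have := hall k
      rw [if_neg hk.symm, if_neg hk'.symm, mul_zero, mul_zero, zero_add, zero_add] at this
      exact hinj _ _ k hne (mul_left_cancel₀ h0.ne' this)
    have hSS : S = S' := by rw [hSdef, hSdef', ho]
    have htt : τ = τ' := by rw [hτσ, hτσ', hSS]
    by_cases he : evenEnd i = evenEnd j
    · have hij := same i j he ho
      exact ⟨hij, hst hij htt⟩
    · have := hall (evenEnd i)
      rw [if_pos rfl, if_neg (Ne.symm he), ho] at this
      have t1 : τ = 1 := by linarith
      have t1' : τ' = 1 := htt ▸ t1
      exact ⟨sameOdd i j (hoi t1).1 (hoj t1').1 ho, (hoi t1).2.trans (hoj t1').2.symm⟩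

/-! ### Interlocked hexagons are ambient isotopic to each other -/

theorem normal_swap (a b : E3) : normal a b = -normal b a := by
  ext k
  fin_cases k <;> simp [normal] <;> ring

theorem normal_ne_zero_iff {a b : E3} (hb : b ≠ 0) :
    normal a b ≠ 0 ↔ a ∉ Submodule.span ℝ {b} := by
  rw [not_iff_not, Submodule.mem_span_singleton]
  constructor
  · intro h
    have hN : ∀ k, normal a b k = 0 := fun k => by rw [h]; rfl
    have h0 := hN 0
    have h1 := hN 1
    have h2 := hN 2
    simp only [normal, Matrix.cons_val] at h0 h1 h2
    have hpos : 0 < ‖b‖ ^ 2 := by positivity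
    rw [EuclideanSpace.norm_sq_eq, Fin.sum_univ_three] at hpos
    simp only [Real.norm_eq_abs, sq_abs] at hpos
    -- The coefficient of the orthogonal projection of `a` onto the line of `b`.
    refine ⟨(a 0 * b 0 + a 1 * b 1 + a 2 * b 2) / (b 0 ^ 2 + b 1 ^ 2 + b 2 ^ 2), ?_⟩
    ext k
    fin_cases k <;> simp <;> field_simp
    · linear_combination b 1 * h2 - b 2 * h1
    · linear_combination b 2 * h0 - b 0 * h2
    · linear_combination b 0 * h1 - b 1 * h0
  · rintro ⟨c, rfl⟩
    ext k
    fin_cases k <;> simp [normal] <;> ring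

theorem isConnected_setOf_normal_ne_zero {b : E3} (hb : b ≠ 0) :
    IsConnected {a | normal a b ≠ 0} := by
  have : {a | normal a b ≠ 0} = (Submodule.span ℝ {b} : Set E3)ᶜ := by
    ext a; exact normal_ne_zero_iff hb
  rw [this]
  refine isConnected_compl_of_one_lt_codim ?_
  have h := Submodule.finrank_quotient_add_finrank (Submodule.span ℝ {b})
  rw [finrank_span_singleton hb, finrank_euclideanSpace_fin] at h
  rw [← Module.finrank_eq_rank]
  have : Module.finrank ℝ (E3 ⧸ Submodule.span ℝ {b}) = 2 := by omega
  rw [this]; norm_num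

theorem isPreconnected_setOf_normal_ne_zero (b : E3) : IsPreconnected {a | normal a b ≠ 0} := by
  by_cases hb : b = 0
  · have : {a | normal a b ≠ 0} = ∅ := by
      ext a
      simp only [mem_ofPred_eq, mem_empty_iff_false, iff_false, not_not]
      ext k; fin_cases k <;> simp [normal, hb]
    rw [this]; exact isPreconnected_empty
  · exact (isConnected_setOf_normal_ne_zero hb).isPreconnected

/-- Supplies the intermediate vector for changing a frame one vector at a time. If `b` and `c` are
independent, `b + c` works; otherwise they span the same line. -/
theorem exists_normal_ne_zero {b c : E3} (hb : b ≠ 0) (hc : c ≠ 0) :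
    ∃ a, normal a b ≠ 0 ∧ normal a c ≠ 0 := by
  by_cases h : normal c b = 0
  · obtain ⟨a, ha⟩ := (isConnected_setOf_normal_ne_zero hb).nonempty
    refine ⟨a, ha, fun hac => ?_⟩
    have h1 := not_not.1 (mt (normal_ne_zero_iff hc).2 (not_not.2 hac))
    have h2 := not_not.1 (mt (normal_ne_zero_iff hb).2 (not_not.2 h))
    exact (normal_ne_zero_iff hb).1 ha
      ((Submodule.span_singleton_le_iff_mem _ _).2 h2 h1)
  · refine ⟨b + c, ?_, ?_⟩
    · have : normal (b + c) b = normal c b := by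
        ext k; fin_cases k <;> simp [normal] <;> ring
      rwa [this]
    · have : normal (b + c) c = -normal c b := by
        ext k; fin_cases k <;> simp [normal] <;> ring
      rwa [this, neg_ne_zero]

theorem continuous_normal : Continuous fun q : E3 × E3 => normal q.1 q.2 := by
  unfold normal
  refine (PiLp.continuous_toLp 2 _).comp (continuous_pi fun k => ?_)
  fin_cases k <;> simp <;> fun_prop

theorem continuousOn_frameHexagon :
    ContinuousOn (fun q : E3 × E3 × E3 × (Fin 3 → Fin 3 → ℝ) =>
      frameHexagon q.1 q.2.1 q.2.2.1 q.2.2.2) {q | q.2.2.2 ∈ interlockedWeights} := by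
  have h : ∀ i, ContinuousOn (fun q : E3 × E3 × E3 × (Fin 3 → Fin 3 → ℝ) =>
      apexPoint q.1 q.2.1 q.2.2.1 (q.2.2.2 i)) {q | q.2.2.2 ∈ interlockedWeights} := by
    intro i
    unfold apexPoint
    have hn : Continuous fun q : E3 × E3 × E3 × (Fin 3 → Fin 3 → ℝ) => normal q.2.1 q.2.2.1 :=
      continuous_normal.comp (by fun_prop : Continuous fun q : E3 × E3 × E3 × (Fin 3 → Fin 3 → ℝ) =>
        (q.2.1, q.2.2.1))
    have hs : Continuous fun q : E3 × E3 × E3 × (Fin 3 → Fin 3 → ℝ) =>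
        q.2.2.2 i 0 + q.2.2.2 i 1 + q.2.2.2 i 2 := by fun_prop
    have hc : Continuous fun q : E3 × E3 × E3 × (Fin 3 → Fin 3 → ℝ) =>
        q.2.2.2 i 1 • q.2.1 + q.2.2.2 i 2 • q.2.2.1 + normal q.2.1 q.2.2.1 := by fun_prop
    exact continuousOn_fst.add
      ((hs.continuousOn.inv₀ fun q hq => (hq.1 i).ne').smul hc.continuousOn)
  refine continuousOn_pi.2 fun k => ?_
  fin_cases k
  · exact continuousOn_fst
  · exact h 0
  · exact (by fun_prop : Continuous fun q : E3 × E3 × E3 × (Fin 3 → Fin 3 → ℝ) =>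
      q.1 + q.2.1).continuousOn
  · exact h 1
  · exact (by fun_prop : Continuous fun q : E3 × E3 × E3 × (Fin 3 → Fin 3 → ℝ) =>
      q.1 + q.2.2.1).continuousOn
  · exact h 2

theorem ambientIsotopic_frameHexagon_of_isPreconnected
    {S : Set (E3 × E3 × E3 × (Fin 3 → Fin 3 → ℝ))} (hS : IsPreconnected S)
    (hab : ∀ q ∈ S, normal q.2.1 q.2.2.1 ≠ 0) (hw : ∀ q ∈ S, q.2.2.2 ∈ interlockedWeights)
    {q q' : E3 × E3 × E3 × (Fin 3 → Fin 3 → ℝ)} (hq : q ∈ S) (hq' : q' ∈ S) :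
    AmbientIsotopic (closedHexagon (frameHexagon q.1 q.2.1 q.2.2.1 q.2.2.2))
      (closedHexagon (frameHexagon q'.1 q'.2.1 q'.2.2.1 q'.2.2.2)) := by
  refine ambientIsotopic_of_isPreconnected (hS.image _ (continuousOn_frameHexagon.mono hw)) ?_
    (mem_image_of_mem _ hq) (mem_image_of_mem _ hq')
  rintro _ ⟨q, hq, rfl⟩
  exact isSimpleHexagon_frameHexagon _ (hab q hq) (hw q hq)

/-- The frame passes through `(c, b)` and `(c, b')`, each move taking place in the complement of a
line, which is connected; then the origin and the weights move in convex sets. Orientation is no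
obstruction, since `normal a b` always completes `a, b` to a negative frame. -/
theorem ambientIsotopic_frameHexagon {o a b o' a' b' : E3} {w w' : Fin 3 → Fin 3 → ℝ}
    (hab : normal a b ≠ 0) (hab' : normal a' b' ≠ 0) (hw : w ∈ interlockedWeights)
    (hw' : w' ∈ interlockedWeights) :
    AmbientIsotopic (closedHexagon (frameHexagon o a b w))
      (closedHexagon (frameHexagon o' a' b' w')) := by
  have fst : ∀ {a a' b : E3}, normal a b ≠ 0 → normal a' b ≠ 0 →
      AmbientIsotopic (closedHexagon (frameHexagon o a b w))
        (closedHexagon (frameHexagon o a' b w)) := by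
    intro a a' b h h'
    refine ambientIsotopic_frameHexagon_of_isPreconnected
      (S := {o} ×ˢ {x | normal x b ≠ 0} ×ˢ {b} ×ˢ {w})
      (q := (o, a, b, w)) (q' := (o, a', b, w))
      (isPreconnected_singleton.prod ((isPreconnected_setOf_normal_ne_zero b).prod
        (isPreconnected_singleton.prod isPreconnected_singleton))) ?_ ?_ (by simpa) (by simpa)
    · rintro ⟨_, x, _, _⟩ ⟨rfl, hx, rfl, rfl⟩; exact hx
    · rintro ⟨_, x, _, _⟩ ⟨rfl, hx, rfl, rfl⟩; exact hw
  have snd : ∀ {a b b' : E3}, normal a b ≠ 0 → normal a b' ≠ 0 →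
      AmbientIsotopic (closedHexagon (frameHexagon o a b w))
        (closedHexagon (frameHexagon o a b' w)) := by
    intro a b b' h h'
    have swap : ∀ x : E3, normal x a ≠ 0 ↔ normal a x ≠ 0 := fun x => by
      rw [normal_swap x a, neg_ne_zero]
    refine ambientIsotopic_frameHexagon_of_isPreconnected
      (S := {o} ×ˢ {a} ×ˢ {x | normal x a ≠ 0} ×ˢ {w})
      (q := (o, a, b, w)) (q' := (o, a, b', w))
      (isPreconnected_singleton.prod (isPreconnected_singleton.prod
        ((isPreconnected_setOf_normal_ne_zero a).prod isPreconnected_singleton))) ?_ ?_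
        (by simpa [swap] using h) (by simpa [swap] using h')
    · rintro ⟨_, _, x, _⟩ ⟨rfl, rfl, hx, rfl⟩; exact (swap x).1 hx
    · rintro ⟨_, _, x, _⟩ ⟨rfl, rfl, hx, rfl⟩; exact hw
  have rest : AmbientIsotopic (closedHexagon (frameHexagon o a' b' w))
      (closedHexagon (frameHexagon o' a' b' w')) := by
    refine ambientIsotopic_frameHexagon_of_isPreconnected
      (S := univ ×ˢ {a'} ×ˢ {b'} ×ˢ interlockedWeights)
      (q := (o, a', b', w)) (q' := (o', a', b', w'))
      (isPreconnected_univ.prod (isPreconnected_singleton.prod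
        (isPreconnected_singleton.prod convex_interlockedWeights.isPreconnected))) ?_ ?_
        (by simpa) (by simpa)
    · rintro ⟨_, _, _, _⟩ ⟨-, rfl, rfl, -⟩; exact hab'
    · rintro ⟨_, _, _, _⟩ ⟨-, rfl, rfl, h⟩; exact h
  have hne : ∀ {a b : E3}, normal a b ≠ 0 → b ≠ 0 := by
    rintro a b h rfl
    exact h (by ext k; fin_cases k <;> simp [normal])
  obtain ⟨c, hc, hc'⟩ := exists_normal_ne_zero (hne hab) (hne hab')
  exact (((fst hab hc).trans (snd hc hc')).trans (fst hc' hab')).trans rest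

/-- A positively interlocked hexagon is given by interlocked weights. -/
theorem IsPositivelyInterlocked.exists_eq_frameHexagon {v : Fin 6 → E3}
    (h : IsPositivelyInterlocked fun i j k l => orient (v i) (v j) (v k) (v l)) :
    ∃ o a b w, normal a b ≠ 0 ∧ w ∈ interlockedWeights ∧ v = frameHexagon o a b w := by
  obtain ⟨⟨a1, a3, a5⟩, ⟨p1, p2⟩, ⟨q1, q2⟩, r1, r2⟩ := h
  set a := v 2 - v 0 with ha
  set b := v 4 - v 0 with hb
  have hab : normal a b ≠ 0 := by
    intro h
    have e : orient (v 0) (v 2) (v 4) (v 1) = -(normal a b 0 * (v 1 - v 0) 0 +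
      normal a b 1 * (v 1 - v 0) 1 + normal a b 2 * (v 1 - v 0) 2) := by
      rw [orient, ← ha, ← hb]
      simp [tripleDet, normal]; ring
    rw [h] at e
    simp [e] at a1
  have hN := normal_sq_pos hab
  set D := tripleDet a b (normal a b) with hD
  have hDneg : D < 0 := by rw [hD, tripleDet_normal]; linarith
  set q : Fin 6 → ℝ := fun i => tripleDet (v i - v 0) b (normal a b) / D with hq
  set r : Fin 6 → ℝ := fun i => tripleDet a (v i - v 0) (normal a b) / D with hr
  set z : Fin 6 → ℝ := fun i => tripleDet a b (v i - v 0) / D with hz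
  have hsub : ∀ i, v i - v 0 = q i • a + r i • b + z i • normal a b := by
    intro i
    have e := eq_combination a b (v i - v 0)
    have e' : v i - v 0 = D⁻¹ • (D • (v i - v 0)) := by
      rw [smul_smul, inv_mul_cancel₀ hDneg.ne, one_smul]
    rw [← hD] at e
    rw [e'.trans (congrArg (D⁻¹ • ·) e)]
    simp only [hq, hr, hz, div_eq_inv_mul]
    module
  have hv : ∀ i, v i = v 0 + q i • a + r i • b + z i • normal a b := fun i => by
    rw [sub_eq_iff_eq_add'.1 (hsub i)]; abel
  have unit : ∀ i (x y t : ℝ), v i - v 0 = x • a + y • b + t • normal a b →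
      q i = x ∧ r i = y ∧ z i = t :=
    fun i x y t e => combination_injective hab ((hsub i).symm.trans e)
  obtain ⟨q0, r0, z0⟩ := unit 0 0 0 0 (by simp)
  obtain ⟨q2', r2', z2⟩ := unit 2 1 0 0 (by simp [ha])
  obtain ⟨q4, r4, z4⟩ := unit 4 0 1 0 (by simp [hb])
  have ho := orient_eq_mul_coordDet hv
  rw [← hD] at ho
  simp only [ho, coordDet, q0, r0, z0, q2', r2', z2, q4, r4, z4] at a1 a3 a5 p1 p2 q1 q2 r1 r2
  have pos : ∀ {x : ℝ}, D * x < 0 → 0 < x := fun {x} h => by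
    by_contra hx
    push Not at hx
    nlinarith [mul_nonneg_of_nonpos_of_nonpos hDneg.le hx]
  replace a1 : 0 < z 1 := by have := pos a1; linarith
  replace a3 : 0 < z 3 := by have := pos a3; linarith
  replace a5 : 0 < z 5 := by have := pos a5; linarith
  replace p1 := pos p1
  replace p2 := pos p2
  replace q1 := pos q1
  replace q2 := pos q2
  replace r1 := pos r1
  replace r2 := pos r2
  -- Barycentric coordinates of the projection, divided by the height: their sum is the inverse
  -- height, as in `apexPoint`.
  set W : Fin 6 → Fin 3 → ℝ := fun i => ![(1 - q i - r i) / z i, q i / z i, r i / z i] with hW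
  have hsum : ∀ i, W i 0 + W i 1 + W i 2 = (z i)⁻¹ := by
    intro i; simp [hW]; ring
  have hvert : ∀ i, 0 < z i → v i = apexPoint (v 0) a b (W i) := by
    intro i hi
    rw [apexPoint, hsum, inv_inv]
    nth_rewrite 1 [hv i]
    simp only [hW, Matrix.cons_val, smul_add, smul_smul, mul_div_cancel₀ _ hi.ne']
    abel
  refine ⟨v 0, a, b, ![W 1, W 3, W 5], hab, ⟨?_, ⟨?_, ?_⟩, ⟨?_, ?_⟩, ?_, ?_⟩, ?_⟩
  · intro i
    fin_cases i <;> simp only [Fin.zero_eta, Fin.mk_one, Fin.reduceFinMk, Matrix.cons_val, hsum] <;>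
      positivity
  · simp only [hW, Matrix.cons_val]; rw [div_lt_div_iff₀ a5 a3]; linarith
  · simp only [hW, Matrix.cons_val]; rw [div_lt_div_iff₀ a1 a5]; linarith
  · simp only [hW, Matrix.cons_val]; rw [div_lt_div_iff₀ a1 a5]; linarith
  · simp only [hW, Matrix.cons_val]; rw [div_lt_div_iff₀ a3 a1]; linarith
  · simp only [hW, Matrix.cons_val]; rw [div_lt_div_iff₀ a3 a1]; linarith
  · simp only [hW, Matrix.cons_val]; rw [div_lt_div_iff₀ a5 a3]; linarith
  · funext i
    fin_cases i
    · rfl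
    · exact hvert 1 a1
    · simp [frameHexagon, ha]
    · exact hvert 3 a3
    · simp [frameHexagon, hb]
    · exact hvert 5 a5

theorem isPositivelyInterlocked_modelTrefoil : IsPositivelyInterlocked fun i j k l =>
    orient (modelTrefoil i) (modelTrefoil j) (modelTrefoil k) (modelTrefoil l) := by
  refine ⟨⟨?_, ?_, ?_⟩, ⟨?_, ?_⟩, ⟨?_, ?_⟩, ?_, ?_⟩ <;>
    simp [orient, tripleDet, modelTrefoil] <;> norm_num

/-- Positively interlocked hexagons are right-handed trefoils. -/
theorem IsPositivelyInterlocked.isRightHandedTrefoil {v : Fin 6 → E3}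
    (h : IsPositivelyInterlocked fun i j k l => orient (v i) (v j) (v k) (v l)) :
    IsRightHandedTrefoil v := by
  obtain ⟨o, a, b, w, hab, hw, rfl⟩ := h.exists_eq_frameHexagon
  obtain ⟨o', a', b', w', hab', hw', e⟩ :=
    isPositivelyInterlocked_modelTrefoil.exists_eq_frameHexagon
  refine ⟨isSimpleHexagon_frameHexagon o hab hw, ?_⟩
  rw [e]
  exact ambientIsotopic_frameHexagon hab hab' hw hw'

/-! ### Points of a circle in homogeneous coordinates -/

/-- Distinct points of a circle are not collinear. -/
theorem area_ne_zero_of_circle {ρ q₀ r₀ q₁ r₁ q₂ r₂ : ℝ} (h₀ : q₀ ^ 2 + r₀ ^ 2 = ρ)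
    (h₁ : q₁ ^ 2 + r₁ ^ 2 = ρ) (h₂ : q₂ ^ 2 + r₂ ^ 2 = ρ)
    (d₀₁ : 0 < (q₀ - q₁) ^ 2 + (r₀ - r₁) ^ 2) (d₀₂ : 0 < (q₀ - q₂) ^ 2 + (r₀ - r₂) ^ 2)
    (d₁₂ : 0 < (q₁ - q₂) ^ 2 + (r₁ - r₂) ^ 2) :
    (q₁ - q₀) * (r₂ - r₀) - (r₁ - r₀) * (q₂ - q₀) ≠ 0 := by
  intro h
  obtain ⟨e, rfl⟩ : ∃ e, q₁ = q₀ + e := ⟨q₁ - q₀, by ring⟩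
  obtain ⟨e', rfl⟩ : ∃ e, r₁ = r₀ + e := ⟨r₁ - r₀, by ring⟩
  obtain ⟨f, rfl⟩ : ∃ e, q₂ = q₀ + e := ⟨q₂ - q₀, by ring⟩
  obtain ⟨f', rfl⟩ : ∃ e, r₂ = r₀ + e := ⟨r₂ - r₀, by ring⟩
  have hx : e * f' - e' * f = 0 := by linear_combination h
  have he : e ^ 2 + e' ^ 2 + 2 * (e * q₀ + e' * r₀) = 0 := by linear_combination h₁ - h₀
  have hf : f ^ 2 + f' ^ 2 + 2 * (f * q₀ + f' * r₀) = 0 := by linear_combination h₂ - h₀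
  have pe : 0 < e ^ 2 + e' ^ 2 := by linarith
  have pf : 0 < f ^ 2 + f' ^ 2 := by linarith
  -- For parallel chords `(e, e')` and `(f, f')` from one point of the circle, both squared lengths
  -- equal the inner product, so the chords are equal, against `d₁₂`.
  have e1 : (e ^ 2 + e' ^ 2) * (f ^ 2 + f' ^ 2 - (e * f + e' * f')) = 0 := by
    linear_combination (e ^ 2 + e' ^ 2) * hf - (e * f + e' * f') * he -
      2 * (q₀ * (-e') + r₀ * e) * hx
  have e2 : (f ^ 2 + f' ^ 2) * (e ^ 2 + e' ^ 2 - (e * f + e' * f')) = 0 := by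
    linear_combination (f ^ 2 + f' ^ 2) * he - (e * f + e' * f') * hf -
      2 * (q₀ * f' - r₀ * f) * hx
  have e3 := (mul_eq_zero.1 e1).resolve_left pe.ne'
  have e4 := (mul_eq_zero.1 e2).resolve_left pf.ne'
  nlinarith

/-- A point of a circle which is a combination of three points of the circle. -/
theorem null_combination {ρ q₀ r₀ q₁ r₁ q₂ r₂ q r c y₀ y₁ y₂ : ℝ} (h₀ : q₀ ^ 2 + r₀ ^ 2 = ρ)
    (h₁ : q₁ ^ 2 + r₁ ^ 2 = ρ) (h₂ : q₂ ^ 2 + r₂ ^ 2 = ρ) (h : q ^ 2 + r ^ 2 = ρ)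
    (hc : c = y₀ + y₁ + y₂) (hq : c * q = y₀ * q₀ + y₁ * q₁ + y₂ * q₂)
    (hr : c * r = y₀ * r₀ + y₁ * r₁ + y₂ * r₂) :
    y₀ * y₁ * ((q₀ - q₁) ^ 2 + (r₀ - r₁) ^ 2) + y₀ * y₂ * ((q₀ - q₂) ^ 2 + (r₀ - r₂) ^ 2) +
      y₁ * y₂ * ((q₁ - q₂) ^ 2 + (r₁ - r₂) ^ 2) = 0 := by
  have e : (c * q) ^ 2 + (c * r) ^ 2 = c ^ 2 * ρ := by rw [← h]; ring
  rw [hq, hr, hc] at e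
  linear_combination -e + (y₀ ^ 2 + y₀ * y₁ + y₀ * y₂) * h₀ + (y₁ ^ 2 + y₀ * y₁ + y₁ * y₂) * h₁ +
    (y₂ ^ 2 + y₀ * y₂ + y₁ * y₂) * h₂

theorem sq_dist_eq_zero_of_mul {q q' r r' c : ℝ} (hc : c ≠ 0) (hq : c * q = c * q')
    (hr : c * r = c * r') : (q - q') ^ 2 + (r - r') ^ 2 = 0 := by
  rw [mul_left_cancel₀ hc hq, mul_left_cancel₀ hc hr]; ring

theorem exists_sum_zero_of_mixed_signs {x y z : ℝ} (hx : x ≠ 0) (hy : y ≠ 0) (hz : z ≠ 0)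
    (hpos : ¬(0 < x ∧ 0 < y ∧ 0 < z)) (hneg : ¬(x < 0 ∧ y < 0 ∧ z < 0)) :
    ∃ α β γ : ℝ, α + β + γ = 0 ∧ 0 < x * α ∧ 0 < y * β ∧ 0 < z * γ := by
  rcases hx.lt_or_gt with hx | hx <;> rcases hy.lt_or_gt with hy | hy <;>
    rcases hz.lt_or_gt with hz | hz
  · exact (hneg ⟨hx, hy, hz⟩).elim
  · exact ⟨-1, -1, 2, by norm_num, by linarith, by linarith, by linarith⟩
  · exact ⟨-1, 2, -1, by norm_num, by linarith, by linarith, by linarith⟩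
  · exact ⟨-2, 1, 1, by norm_num, by linarith, by linarith, by linarith⟩
  · exact ⟨2, -1, -1, by norm_num, by linarith, by linarith, by linarith⟩
  · exact ⟨1, -2, 1, by norm_num, by linarith, by linarith, by linarith⟩
  · exact ⟨1, 1, -2, by norm_num, by linarith, by linarith, by linarith⟩
  · exact (hpos ⟨hx, hy, hz⟩).elim

/-- A small perturbation of the weights `1, 1, 1` satisfying the inequalities to which the
interlocking conditions reduce. -/
theorem exists_weights {a₀ a₂ a₄ p₀ p₂ p₄ : ℝ} (ha₀ : a₀ < 0) (ha₂ : a₂ < 0) (ha₄ : a₄ < 0)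
    (h₀ : p₀ ≠ 0) (h₂ : p₂ ≠ 0) (h₄ : p₄ ≠ 0) (hpos : ¬(0 < p₀ ∧ 0 < p₂ ∧ 0 < p₄))
    (hneg : ¬(p₀ < 0 ∧ p₂ < 0 ∧ p₄ < 0)) :
    ∃ m₁ m₃ m₅ : ℝ, (0 < m₁ ∧ 0 < m₃ ∧ 0 < m₅) ∧
      (0 < (p₀ - a₀) * m₅ - p₀ * m₃ ∧ 0 < p₀ * m₁ - p₀ * m₅) ∧
      (0 < (p₂ - a₂) * m₁ - p₂ * m₅ ∧ 0 < p₂ * m₃ - p₂ * m₁) ∧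
      0 < (p₄ - a₄) * m₃ - p₄ * m₁ ∧ 0 < p₄ * m₅ - p₄ * m₃ := by
  -- The weights `1 + ε * α`, `1 + ε * (α + β)`, `1` have cyclic differences `ε * α`, `ε * β`, `ε *
  -- γ`, with the signs of `p₀`, `p₂`, `p₄`. The other three inequalities hold at `ε = 0` because
  -- the `a`'s are negative.
  obtain ⟨α, β, γ, hs, hα, hβ, hγ⟩ := exists_sum_zero_of_mixed_signs h₀ h₂ h₄ hpos hneg
  have near : ∀ f : ℝ → ℝ, Continuous f → 0 < f 0 → ∀ᶠ ε in 𝓝[>] (0 : ℝ), 0 < f ε :=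
    fun f hf h0 => (hf.tendsto 0).eventually_const_lt h0 |>.filter_mono nhdsWithin_le_nhds
  have key := ((near (fun ε => 1 + ε * α) (by fun_prop) (by simp)).and
    (near (fun ε => 1 + ε * (α + β)) (by fun_prop) (by simp))).and
    ((near (fun ε => (p₀ - a₀) * 1 - p₀ * (1 + ε * (α + β))) (by fun_prop) (by simpa)).and
    ((near (fun ε => (p₂ - a₂) * (1 + ε * α) - p₂ * 1) (by fun_prop) (by simpa)).and
    (near (fun ε => (p₄ - a₄) * (1 + ε * (α + β)) - p₄ * (1 + ε * α)) (by fun_prop) (by simpa))))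
  obtain ⟨ε, ⟨⟨e1, e2⟩, e3, e4, e5⟩, hε⟩ := (key.and self_mem_nhdsWithin).exists
  have hε : 0 < ε := hε
  refine ⟨1 + ε * α, 1 + ε * (α + β), 1, ⟨e1, e2, one_pos⟩, ⟨e3, ?_⟩, ⟨e4, ?_⟩, e5, ?_⟩
  · have := mul_pos hε hα; linarith
  · have := mul_pos hε hβ; linarith
  · have e : p₄ * 1 - p₄ * (1 + ε * (α + β)) = ε * (p₄ * γ) := by
      rw [show γ = -(α + β) by linarith]; ring
    rw [e]; exact mul_pos hε hγ

theorem coordDet_of_base {q r h : Fin 6 → ℝ} {i j : Fin 6} (hi : h i = 0) (hj : h j = 0)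
    (k l : Fin 6) : coordDet q r h i j k l =
      ((q j - q i) * (r k - r i) - (r j - r i) * (q k - q i)) * h l -
        ((q j - q i) * (r l - r i) - (r j - r i) * (q l - q i)) * h k := by
  rw [coordDet, hi, hj]; ring

/-- Let six points of a circle lie, in opposite pairs, on three concurrent lines, the two
homogeneous weights on each line having opposite signs. Then the barycentric coordinates of the point
of concurrency with respect to every other point are nonzero and of different signs. -/
theorem exists_barycentric_of_circle {q r : Fin 6 → ℝ} {ρ : ℝ}
    (hcirc : ∀ i, q i ^ 2 + r i ^ 2 = ρ)
    (hd : ∀ i j, i ≠ j → 0 < (q i - q j) ^ 2 + (r i - r j) ^ 2) {a : Fin 6 → ℝ}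
    (ha₀ : a 0 < 0) (ha₁ : 0 < a 1) (ha₃ : 0 < a 3)
    {w x y : ℝ} (w₀ : a 0 + a 3 = w) (w₁ : a 1 + a 4 = w)
    (x₀ : a 0 * q 0 + a 3 * q 3 = x) (x₁ : a 1 * q 1 + a 4 * q 4 = x)
    (y₀ : a 0 * r 0 + a 3 * r 3 = y) (y₁ : a 1 * r 1 + a 4 * r 4 = y) :
    ∃ p₀ p₂ p₄ : ℝ, w = p₀ + p₂ + p₄ ∧ x = p₀ * q 0 + p₂ * q 2 + p₄ * q 4 ∧
      y = p₀ * r 0 + p₂ * r 2 + p₄ * r 4 ∧ p₀ ≠ 0 ∧ p₂ ≠ 0 ∧ p₄ ≠ 0 ∧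
      ¬(0 < p₀ ∧ 0 < p₂ ∧ 0 < p₄) ∧ ¬(p₀ < 0 ∧ p₂ < 0 ∧ p₄ < 0) := by
  have d02 := hd 0 2 (by decide)
  have d04 := hd 0 4 (by decide)
  have d24 := hd 2 4 (by decide)
  have d03 := hd 0 3 (by decide)
  set Δ := (q 2 - q 0) * (r 4 - r 0) - (r 2 - r 0) * (q 4 - q 0) with hΔdef
  have hΔ : Δ ≠ 0 := area_ne_zero_of_circle (hcirc 0) (hcirc 2) (hcirc 4) d02 d04 d24
  set p₀ := (w * (q 2 * r 4 - r 2 * q 4) - x * (r 4 - r 2) + y * (q 4 - q 2)) / Δ with hp₀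
  set p₂ := (w * (q 4 * r 0 - r 4 * q 0) - x * (r 0 - r 4) + y * (q 0 - q 4)) / Δ with hp₂
  set p₄ := (w * (q 0 * r 2 - r 0 * q 2) - x * (r 2 - r 0) + y * (q 2 - q 0)) / Δ with hp₄
  have u₀ : Δ * p₀ = w * (q 2 * r 4 - r 2 * q 4) - x * (r 4 - r 2) + y * (q 4 - q 2) := by
    rw [hp₀]; field_simp
  have u₂ : Δ * p₂ = w * (q 4 * r 0 - r 4 * q 0) - x * (r 0 - r 4) + y * (q 0 - q 4) := by
    rw [hp₂]; field_simp
  have u₄ : Δ * p₄ = w * (q 0 * r 2 - r 0 * q 2) - x * (r 2 - r 0) + y * (q 2 - q 0) := by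
    rw [hp₄]; field_simp
  have hw : w = p₀ + p₂ + p₄ := by
    refine mul_left_cancel₀ hΔ ?_
    linear_combination -u₀ - u₂ - u₄ + w * hΔdef
  have hx : x = p₀ * q 0 + p₂ * q 2 + p₄ * q 4 := by
    refine mul_left_cancel₀ hΔ ?_
    linear_combination -u₀ * q 0 - u₂ * q 2 - u₄ * q 4 + x * hΔdef
  have hy : y = p₀ * r 0 + p₂ * r 2 + p₄ * r 4 := by
    refine mul_left_cancel₀ hΔ ?_
    linear_combination -u₀ * r 0 - u₂ * r 2 - u₄ * r 4 + y * hΔdef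
  -- Removing the multiple of point `0` from the point of concurrency leaves `a 3` times point `3`,
  -- with coordinates `(p₀ - a 0, p₂, p₄)`; similarly for point `1`.
  have n3 := null_combination (y₀ := p₀ - a 0) (y₁ := p₂) (y₂ := p₄) (c := a 3)
    (hcirc 0) (hcirc 2) (hcirc 4) (hcirc 3) (by linarith) (by linarith) (by linarith)
  have n1 := null_combination (y₀ := p₀) (y₁ := p₂) (y₂ := p₄ - a 4) (c := a 1)
    (hcirc 0) (hcirc 2) (hcirc 4) (hcirc 1) (by linarith) (by linarith) (by linarith)
  -- The form of `null_combination` at the point of concurrency, evaluated on the chord from `0` to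
  -- `3`. It is negative, as the point is outside the circle.
  have hsum : p₀ * p₂ * ((q 0 - q 2) ^ 2 + (r 0 - r 2) ^ 2) +
      p₀ * p₄ * ((q 0 - q 4) ^ 2 + (r 0 - r 4) ^ 2) +
      p₂ * p₄ * ((q 2 - q 4) ^ 2 + (r 2 - r 4) ^ 2) =
      a 0 * a 3 * ((q 0 - q 3) ^ 2 + (r 0 - r 3) ^ 2) := by
    have e1 : x ^ 2 + y ^ 2 - w ^ 2 * ρ = -(a 0 * a 3 * ((q 0 - q 3) ^ 2 + (r 0 - r 3) ^ 2)) := by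
      rw [← x₀, ← y₀, ← w₀]
      linear_combination (a 0 ^ 2 + a 0 * a 3) * hcirc 0 + (a 3 ^ 2 + a 0 * a 3) * hcirc 3
    rw [hw, hx, hy] at e1
    linear_combination -e1 + (p₀ ^ 2 + p₀ * p₂ + p₀ * p₄) * hcirc 0 +
      (p₂ ^ 2 + p₀ * p₂ + p₂ * p₄) * hcirc 2 + (p₄ ^ 2 + p₀ * p₄ + p₂ * p₄) * hcirc 4
  have distinct : ∀ i j, i ≠ j → ∀ c, c ≠ 0 → c * q i = c * q j → c * r i = c * r j → False :=
    fun i j hij c hc h h' => (hd i j hij).ne' (sq_dist_eq_zero_of_mul hc h h')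
  -- If a coordinate vanishes, `n1` or `n3` reduces to a single product, and its zero factor makes
  -- two of the six points coincide.
  have hp₀' : p₀ ≠ 0 := by
    intro h
    rw [h] at n1 hw hx hy
    have : p₂ * (p₄ - a 4) = 0 := by
      refine (mul_eq_zero.1 (show p₂ * (p₄ - a 4) * _ = 0 by linarith)).resolve_right d24.ne'
    rcases mul_eq_zero.1 this with h' | h'
    · rw [h'] at hw hx hy
      have e : a 1 = p₄ - a 4 := by linarith
      refine distinct 1 4 (by decide) (a 1) ha₁.ne' ?_ ?_
      · rw [e, sub_mul, ← sub_eq_zero, ← sub_eq_zero.2 x₁, e, hx]; ring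
      · rw [e, sub_mul, ← sub_eq_zero, ← sub_eq_zero.2 y₁, e, hy]; ring
    · have h4 : p₄ = a 4 := by linarith
      rw [h4] at hw hx hy
      have e : p₂ = a 1 := by linarith
      rw [e] at hx hy
      exact distinct 1 2 (by decide) (a 1) ha₁.ne' (by linarith) (by linarith)
  have hp₂' : p₂ ≠ 0 := by
    intro h
    rw [h] at n1 hw hx hy
    have : p₀ * (p₄ - a 4) = 0 := by
      refine (mul_eq_zero.1 (show p₀ * (p₄ - a 4) * _ = 0 by linarith)).resolve_right d04.ne'
    have h4 : p₄ = a 4 := by linarith [(mul_eq_zero.1 this).resolve_left hp₀']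
    rw [h4] at hw hx hy
    have e : p₀ = a 1 := by linarith
    rw [e] at hx hy
    exact distinct 1 0 (by decide) (a 1) ha₁.ne' (by linarith) (by linarith)
  have hp₄' : p₄ ≠ 0 := by
    intro h
    rw [h] at n3 hw hx hy
    have : (p₀ - a 0) * p₂ = 0 := by
      refine (mul_eq_zero.1 (show (p₀ - a 0) * p₂ * _ = 0 by linarith)).resolve_right d02.ne'
    have h0 : p₀ = a 0 := by linarith [(mul_eq_zero.1 this).resolve_right hp₂']
    rw [h0] at hw hx hy
    have e : p₂ = a 3 := by linarith
    rw [e] at hx hy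
    exact distinct 3 2 (by decide) (a 3) ha₃.ne' (by linarith) (by linarith)
  have hpos : ¬(0 < p₀ ∧ 0 < p₂ ∧ 0 < p₄) := by
    rintro ⟨h0, h2, h4⟩
    have h0' : 0 < p₀ - a 0 := by linarith
    have t1 := mul_pos (mul_pos h0' h2) d02
    have t2 := mul_pos (mul_pos h0' h4) d04
    have t3 := mul_pos (mul_pos h2 h4) d24
    linarith
  have hneg : ¬(p₀ < 0 ∧ p₂ < 0 ∧ p₄ < 0) := by
    rintro ⟨h0, h2, h4⟩
    have t1 := mul_pos (mul_pos_of_neg_of_neg h0 h2) d02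
    have t2 := mul_pos (mul_pos_of_neg_of_neg h0 h4) d04
    have t3 := mul_pos (mul_pos_of_neg_of_neg h2 h4) d24
    have t4 := mul_neg_of_neg_of_pos (mul_neg_of_neg_of_pos ha₀ ha₃) d03
    linarith
  exact ⟨p₀, p₂, p₄, hw, hx, hy, hp₀', hp₂', hp₄', hpos, hneg⟩

/-- Six points of a circle as in `exists_barycentric_of_circle` can be lifted to the vertices of an
interlocked hexagon. -/
theorem exists_interlocked_heights {q r : Fin 6 → ℝ} {ρ κ : ℝ} (hκ : κ ≠ 0)
    (hcirc : ∀ i, q i ^ 2 + r i ^ 2 = ρ)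
    (hd : ∀ i j, i ≠ j → 0 < (q i - q j) ^ 2 + (r i - r j) ^ 2) {a : Fin 6 → ℝ}
    (ha₀ : a 0 < 0) (ha₁ : 0 < a 1) (ha₂ : a 2 < 0) (ha₃ : 0 < a 3) (ha₄ : a 4 < 0) (ha₅ : 0 < a 5)
    {w x y : ℝ} (w₀ : a 0 + a 3 = w) (w₁ : a 1 + a 4 = w) (w₂ : a 2 + a 5 = w)
    (x₀ : a 0 * q 0 + a 3 * q 3 = x) (x₁ : a 1 * q 1 + a 4 * q 4 = x)
    (x₂ : a 2 * q 2 + a 5 * q 5 = x) (y₀ : a 0 * r 0 + a 3 * r 3 = y)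
    (y₁ : a 1 * r 1 + a 4 * r 4 = y) (y₂ : a 2 * r 2 + a 5 * r 5 = y) :
    ∃ h : Fin 6 → ℝ, IsPositivelyInterlocked fun i j k l => κ * coordDet q r h i j k l := by
  obtain ⟨p₀, p₂, p₄, hw, hx, hy, hp₀, hp₂, hp₄, hpos, hneg⟩ :=
    exists_barycentric_of_circle hcirc hd ha₀ ha₁ ha₃ w₀ w₁ x₀ x₁ y₀ y₁
  obtain ⟨m₁, m₃, m₅, ⟨hm₁, hm₃, hm₅⟩, ⟨c1, c2⟩, ⟨c3, c4⟩, c5, c6⟩ :=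
    exists_weights ha₀ ha₂ ha₄ hp₀ hp₂ hp₄ hpos hneg
  rw [hw] at w₀ w₁ w₂
  rw [hx] at x₀ x₁ x₂
  rw [hy] at y₀ y₁ y₂
  set Δ := (q 2 - q 0) * (r 4 - r 0) - (r 2 - r 0) * (q 4 - q 0) with hΔdef
  have hΔ : Δ ≠ 0 := area_ne_zero_of_circle (hcirc 0) (hcirc 2) (hcirc 4) (hd 0 2 (by decide))
    (hd 0 4 (by decide)) (hd 2 4 (by decide))
  -- The sign of `κ * Δ` is unknown; this factor lifts the odd points to the side that makes the
  -- determinants negative. The opposite side would give the mirror image.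
  set s := -(κ * Δ) with hs
  have hss : κ * Δ * s < 0 := by
    rw [hs]
    have : 0 < (κ * Δ) ^ 2 := by positivity
    linarith
  have final : ∀ D c t : ℝ, 0 < c → 0 < t → c * D = κ * Δ * s * t → D < 0 := by
    intro D c t hc ht e
    have : c * D < 0 := e ▸ mul_neg_of_neg_of_pos hss ht
    exact neg_of_mul_neg_right this hc.le
  have i1 : a 1 * (m₁ / a 1) = m₁ := by field_simp
  have i3 : a 3 * (m₃ / a 3) = m₃ := by field_simp
  have i5 : a 5 * (m₅ / a 5) = m₅ := by field_simp
  -- With `m₁ = m₃ = m₅ = 1` the lines through opposite lifted points would be concurrent.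
  set h₁ := m₁ / a 1
  set h₃ := m₃ / a 3
  set h₅ := m₅ / a 5
  -- areas spanned by two even vertices and an odd one
  have A243 : a 3 * ((q 4 - q 2) * (r 3 - r 2) - (r 4 - r 2) * (q 3 - q 2)) = Δ * (p₀ - a 0) := by
    rw [hΔdef]
    linear_combination (q 2 * r 4 - r 2 * q 4) * w₀ - (r 4 - r 2) * x₀ + (q 4 - q 2) * y₀
  have A245 : a 5 * ((q 4 - q 2) * (r 5 - r 2) - (r 4 - r 2) * (q 5 - q 2)) = Δ * p₀ := by
    rw [hΔdef]
    linear_combination (q 2 * r 4 - r 2 * q 4) * w₂ - (r 4 - r 2) * x₂ + (q 4 - q 2) * y₂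
  have A241 : a 1 * ((q 4 - q 2) * (r 1 - r 2) - (r 4 - r 2) * (q 1 - q 2)) = Δ * p₀ := by
    rw [hΔdef]
    linear_combination (q 2 * r 4 - r 2 * q 4) * w₁ - (r 4 - r 2) * x₁ + (q 4 - q 2) * y₁
  have A405 : a 5 * ((q 0 - q 4) * (r 5 - r 4) - (r 0 - r 4) * (q 5 - q 4)) = Δ * (p₂ - a 2) := by
    rw [hΔdef]
    linear_combination (q 4 * r 0 - r 4 * q 0) * w₂ - (r 0 - r 4) * x₂ + (q 0 - q 4) * y₂
  have A401 : a 1 * ((q 0 - q 4) * (r 1 - r 4) - (r 0 - r 4) * (q 1 - q 4)) = Δ * p₂ := by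
    rw [hΔdef]
    linear_combination (q 4 * r 0 - r 4 * q 0) * w₁ - (r 0 - r 4) * x₁ + (q 0 - q 4) * y₁
  have A403 : a 3 * ((q 0 - q 4) * (r 3 - r 4) - (r 0 - r 4) * (q 3 - q 4)) = Δ * p₂ := by
    rw [hΔdef]
    linear_combination (q 4 * r 0 - r 4 * q 0) * w₀ - (r 0 - r 4) * x₀ + (q 0 - q 4) * y₀
  have A021 : a 1 * ((q 2 - q 0) * (r 1 - r 0) - (r 2 - r 0) * (q 1 - q 0)) = Δ * (p₄ - a 4) := by
    rw [hΔdef]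
    linear_combination (q 0 * r 2 - r 0 * q 2) * w₁ - (r 2 - r 0) * x₁ + (q 2 - q 0) * y₁
  have A023 : a 3 * ((q 2 - q 0) * (r 3 - r 0) - (r 2 - r 0) * (q 3 - q 0)) = Δ * p₄ := by
    rw [hΔdef]
    linear_combination (q 0 * r 2 - r 0 * q 2) * w₀ - (r 2 - r 0) * x₀ + (q 2 - q 0) * y₀
  have A025 : a 5 * ((q 2 - q 0) * (r 5 - r 0) - (r 2 - r 0) * (q 5 - q 0)) = Δ * p₄ := by
    rw [hΔdef]
    linear_combination (q 0 * r 2 - r 0 * q 2) * w₂ - (r 2 - r 0) * x₂ + (q 2 - q 0) * y₂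
  -- Clearing the positive weights of the two odd vertices turns a determinant over an even base
  -- edge into an expression from `exists_weights`.
  have up : ∀ (D A A' ci cj hi hj mi mj U U' : ℝ), D = κ * (A * (s * hj) - A' * (s * hi)) →
      ci * A = Δ * U → cj * A' = Δ * U' → ci * hi = mi → cj * hj = mj →
      ci * cj * D = κ * Δ * s * (U * mj - U' * mi) := by
    intro D A A' ci cj hi hj mi mj U U' hD e1 e2 e3 e4
    rw [hD, ← e3, ← e4]
    linear_combination κ * s * cj * hj * e1 - κ * s * ci * hi * e2
  set H : Fin 6 → ℝ := ![0, s * h₁, 0, s * h₃, 0, s * h₅]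
  refine ⟨H, ⟨?_, ?_, ?_⟩, ⟨?_, ?_⟩, ⟨?_, ?_⟩, ?_, ?_⟩
  · refine final _ 1 h₁ one_pos (by positivity) ?_
    rw [coordDet_of_base (h := H) rfl rfl 4 1, hΔdef]
    change 1 * (κ * (_ * (s * h₁) - _ * 0)) = _
    ring
  · refine final _ 1 h₃ one_pos (by positivity) ?_
    rw [coordDet_of_base (h := H) rfl rfl 4 3, hΔdef]
    change 1 * (κ * (_ * (s * h₃) - _ * 0)) = _
    ring
  · refine final _ 1 h₅ one_pos (by positivity) ?_
    rw [coordDet_of_base (h := H) rfl rfl 4 5, hΔdef]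
    change 1 * (κ * (_ * (s * h₅) - _ * 0)) = _
    ring
  · exact final _ _ _ (mul_pos ha₃ ha₅) c1
      (up _ _ _ _ _ _ _ _ _ _ _ (congrArg (κ * ·) (coordDet_of_base (h := H) rfl rfl 3 5)) A243 A245 i3 i5)
  · exact final _ _ _ (mul_pos ha₅ ha₁) c2
      (up _ _ _ _ _ _ _ _ _ _ _ (congrArg (κ * ·) (coordDet_of_base (h := H) rfl rfl 5 1)) A245 A241 i5 i1)
  · exact final _ _ _ (mul_pos ha₅ ha₁) c3
      (up _ _ _ _ _ _ _ _ _ _ _ (congrArg (κ * ·) (coordDet_of_base (h := H) rfl rfl 5 1)) A405 A401 i5 i1)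
  · exact final _ _ _ (mul_pos ha₁ ha₃) c4
      (up _ _ _ _ _ _ _ _ _ _ _ (congrArg (κ * ·) (coordDet_of_base (h := H) rfl rfl 1 3)) A401 A403 i1 i3)
  · exact final _ _ _ (mul_pos ha₁ ha₃) c5
      (up _ _ _ _ _ _ _ _ _ _ _ (congrArg (κ * ·) (coordDet_of_base (h := H) rfl rfl 1 3)) A021 A023 i1 i3)
  · exact final _ _ _ (mul_pos ha₃ ha₅) c6
      (up _ _ _ _ _ _ _ _ _ _ _ (congrArg (κ * ·) (coordDet_of_base (h := H) rfl rfl 3 5)) A023 A025 i3 i5)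

/-! ### The lines of a triangular prism -/

/-- Here `‖p.1‖ ^ 2 - p.2 ^ 2 = 2 * s * t * (⟪A, B⟫ - 1)` and `⟪p.1, A⟫ - p.2 = t * (⟪A, B⟫ - 1)`,
where `⟪A, B⟫ < 1`. Thus `s` and `t` are nonzero because `p` is outside the ball, and the caps of
the ends determine the signs of the weights. -/
theorem prism_line {p : E4 × ℝ} (hp : p.2 ^ 2 < ‖p.1‖ ^ 2) {A B : E4} (hA : ‖A‖ = 1) (hB : ‖B‖ = 1)
    (hAB : A ≠ B) {s t : ℝ} (h : s • ((A, 1) : E4 × ℝ) + t • ((B, 1) : E4 × ℝ) = p) :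
    (inner ℝ p.1 A - p.2) * t < 0 ∧ (inner ℝ p.1 B - p.2) * s < 0 := by
  subst h
  have hlt := (inner_lt_one_iff_real_of_norm_eq_one hA hB).2 hAB
  have hAA : inner ℝ A A = 1 := by rw [real_inner_self_eq_norm_sq, hA, one_pow]
  have hBB : inner ℝ B B = 1 := by rw [real_inner_self_eq_norm_sq, hB, one_pow]
  rw [← real_inner_self_eq_norm_sq] at hp
  simp only [Prod.smul_mk, Prod.mk_add_mk, smul_eq_mul, mul_one, inner_add_left, inner_add_right,
    real_inner_smul_left, real_inner_smul_right, hAA, hBB, real_inner_comm A B] at hp ⊢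
  have hst : 0 < s * t * (inner ℝ A B - 1) := by
    nlinarith
  have hst' : s ≠ 0 ∧ t ≠ 0 := by
    constructor <;> rintro rfl <;> simp at hst
  have hs : 0 < s ^ 2 := by have := hst'.1; positivity
  have ht : 0 < t ^ 2 := by have := hst'.2; positivity
  constructor <;> nlinarith

/-- A relation between points of the sphere, read off in stereographic coordinates. -/
theorem stereo_line {p : E4 × ℝ} {y z : E3} {s t : ℝ}
    (h : s • ((invStereo y, 1) : E4 × ℝ) + t • ((invStereo z, 1) : E4 × ℝ) = p) :
    s * (‖y‖ ^ 2 + 1)⁻¹ + t * (‖z‖ ^ 2 + 1)⁻¹ = (p.2 - p.1 3) / 2 ∧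
      (s * (‖y‖ ^ 2 + 1)⁻¹) • y + (t * (‖z‖ ^ 2 + 1)⁻¹) • z =
        !₂[p.1 0 / 2, p.1 1 / 2, p.1 2 / 2] := by
  subst h
  have hy : (‖y‖ ^ 2 + 1) ≠ 0 := by positivity
  have hz : (‖z‖ ^ 2 + 1) ≠ 0 := by positivity
  -- The linear map `(y, s) ↦ (y₀, y₁, y₂, s - y₃) / 2` sends `(invStereo z, 1)` to `(‖z‖ ^ 2 + 1)⁻¹
  -- • (z, 1)`.
  constructor
  · simp [invStereo]
    field_simp
    ring
  · ext k
    fin_cases k <;> simp [invStereo] <;> ring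

/-- Six-tuples in the space of prisms lie on three concurrent lines; the weights of the even and of
the odd points have opposite signs. -/
theorem exists_weights_of_mem_prismSpace {y : Fin 6 → E3}
    (h : (fun i => invStereo (y i)) ∈ prismSpace) :
    ∃ (a : Fin 6 → ℝ) (w : ℝ) (x : E3), a 0 < 0 ∧ 0 < a 1 ∧ a 2 < 0 ∧ 0 < a 3 ∧ a 4 < 0 ∧ 0 < a 5 ∧
      (a 0 + a 3 = w ∧ a 1 + a 4 = w ∧ a 2 + a 5 = w) ∧
      a 0 • y 0 + a 3 • y 3 = x ∧ a 1 • y 1 + a 4 • y 4 = x ∧ a 2 • y 2 + a 5 • y 5 = x := by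
  obtain ⟨hnorm, hinj, p, hp, hline, hgraph⟩ := h
  -- Consecutive indices are adjacent in the cycle, hence not in the prism graph, so they are not in
  -- the same cap.
  have hcap : ∀ i : Fin 6, (inner ℝ p.1 (invStereo (y i)) - p.2) *
      (inner ℝ p.1 (invStereo (y (i + 1))) - p.2) ≤ 0 := by
    intro i
    by_contra hcon
    push Not at hcon
    have hne : i ≠ i + 1 := (by decide : ∀ i : Fin 6, i ≠ i + 1) i
    have hadj : (SimpleGraph.cycleGraph 6).Adj i (i + 1) := by
      have : ∀ i : Fin 6, (SimpleGraph.cycleGraph 6).Adj i (i + 1) := by decide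
      exact this i
    rw [← hgraph, SimpleGraph.compl_adj] at hadj
    refine hadj.2 ?_
    rw [prismGraph, SimpleGraph.fromRel_adj]
    exact ⟨hne, Or.inl (Or.inr hcon)⟩
  obtain ⟨s₀, t₃, l₀⟩ := Submodule.mem_span_pair.1 (hline 0)
  obtain ⟨s₁, t₄, l₁⟩ := Submodule.mem_span_pair.1 (hline 1)
  obtain ⟨s₂, t₅, l₂⟩ := Submodule.mem_span_pair.1 (hline 2)
  obtain ⟨b₀, b₃⟩ := prism_line hp (hnorm 0) (hnorm 3) (hinj.ne (by decide)) l₀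
  obtain ⟨b₁, b₄⟩ := prism_line hp (hnorm 1) (hnorm 4) (hinj.ne (by decide)) l₁
  obtain ⟨b₂, b₅⟩ := prism_line hp (hnorm 2) (hnorm 5) (hinj.ne (by decide)) l₂
  obtain ⟨w₀, x₀⟩ := stereo_line l₀
  obtain ⟨w₁, x₁⟩ := stereo_line l₁
  obtain ⟨w₂, x₂⟩ := stereo_line l₂
  have c₀ := hcap 0
  have c₁ := hcap 1
  have c₂ := hcap 2
  have c₃ := hcap 3
  have c₄ := hcap 4
  simp only [Fin.isValue, zero_add, Fin.reduceAdd] at b₀ b₁ b₂ b₃ b₄ b₅ w₀ w₁ w₂ x₀ x₁ x₂ c₀ c₁ c₂ c₃ c₄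
  set f : Fin 6 → ℝ := fun i => inner ℝ p.1 (invStereo (y i)) - p.2
  change f 0 * t₃ < 0 at b₀
  change f 1 * t₄ < 0 at b₁
  change f 2 * t₅ < 0 at b₂
  change f 3 * s₀ < 0 at b₃
  change f 4 * s₁ < 0 at b₄
  change f 5 * s₂ < 0 at b₅
  change f 0 * f 1 ≤ 0 at c₀
  change f 1 * f 2 ≤ 0 at c₁
  change f 2 * f 3 ≤ 0 at c₂
  change f 3 * f 4 ≤ 0 at c₃
  change f 4 * f 5 ≤ 0 at c₄
  have flip : ∀ {u v : ℝ}, u * v ≤ 0 → v ≠ 0 → (0 < u → v < 0) ∧ (u < 0 → 0 < v) := by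
    intro u v h hv
    constructor <;> intro hu
    · exact lt_of_le_of_ne (by by_contra hc; push Not at hc; nlinarith) hv
    · exact lt_of_le_of_ne (by by_contra hc; push Not at hc; nlinarith) hv.symm
  have fne : ∀ {u v : ℝ}, u * v < 0 → u ≠ 0 ∧ v ≠ 0 := by
    intro u v h
    constructor <;> rintro rfl <;> simp at h
  have μ : ∀ i, 0 < (‖y i‖ ^ 2 + 1)⁻¹ := fun i => by positivity
  set m : Fin 6 → ℝ := fun i => (‖y i‖ ^ 2 + 1)⁻¹
  have f0 := fne b₀
  have f1 := fne b₁
  have f2 := fne b₂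
  have f3 := fne b₃
  have f4 := fne b₄
  have f5 := fne b₅
  -- The signs of `f` alternate, and the weight at each point has the sign of `f` there. If `f 0 >
  -- 0`, all weights are negated.
  rcases f0.1.lt_or_gt with h0 | h0
  · have h1 := (flip c₀ f1.1).2 h0
    have h2 := (flip c₁ f2.1).1 h1
    have h3 := (flip c₂ f3.1).2 h2
    have h4 := (flip c₃ f4.1).1 h3
    have h5 := (flip c₄ f5.1).2 h4
    refine ⟨![s₀ * m 0, s₁ * m 1, s₂ * m 2, t₃ * m 3, t₄ * m 4, t₅ * m 5], _, _,
      mul_neg_of_neg_of_pos ((flip b₃.le f3.2).1 h3) (μ 0),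
      mul_pos ((flip b₄.le f4.2).2 h4) (μ 1),
      mul_neg_of_neg_of_pos ((flip b₅.le f5.2).1 h5) (μ 2),
      mul_pos ((flip b₀.le f0.2).2 h0) (μ 3),
      mul_neg_of_neg_of_pos ((flip b₁.le f1.2).1 h1) (μ 4),
      mul_pos ((flip b₂.le f2.2).2 h2) (μ 5), ⟨w₀, w₁, w₂⟩, x₀, x₁, x₂⟩
  · have h1 := (flip c₀ f1.1).1 h0
    have h2 := (flip c₁ f2.1).2 h1
    have h3 := (flip c₂ f3.1).1 h2
    have h4 := (flip c₃ f4.1).2 h3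
    have h5 := (flip c₄ f5.1).1 h4
    have neg : ∀ {a b w : ℝ}, a + b = w → -a + -b = -w := by intros; linarith
    have neg' : ∀ {a b : ℝ} {y z x : E3}, a • y + b • z = x → (-a) • y + (-b) • z = -x := by
      rintro a b y z _ rfl; module
    refine ⟨![-(s₀ * m 0), -(s₁ * m 1), -(s₂ * m 2), -(t₃ * m 3), -(t₄ * m 4), -(t₅ * m 5)], _, _,
      neg_neg_of_pos (mul_pos ((flip b₃.le f3.2).2 h3) (μ 0)),
      neg_pos.2 (mul_neg_of_neg_of_pos ((flip b₄.le f4.2).1 h4) (μ 1)),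
      neg_neg_of_pos (mul_pos ((flip b₅.le f5.2).2 h5) (μ 2)),
      neg_pos.2 (mul_neg_of_neg_of_pos ((flip b₀.le f0.2).1 h0) (μ 3)),
      neg_neg_of_pos (mul_pos ((flip b₁.le f1.2).2 h1) (μ 4)),
      neg_pos.2 (mul_neg_of_neg_of_pos ((flip b₂.le f2.2).1 h2) (μ 5)),
      ⟨neg w₀, neg w₁, neg w₂⟩, neg' x₀, neg' x₁, neg' x₂⟩

/-! ### Choosing the perturbation -/

/-- Near a point where a continuous function changes sign, it takes all small values. -/
theorem exists_forall_abs_lt_exists_eq {f : ℝ → ℝ} (hf : Continuous f) {t δ : ℝ} (hδ : 0 < δ)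
    (h0 : f t = 0) :
    ∃ η > 0, ∀ y, |y| < η → ((∀ᶠ u in 𝓝 t, 0 ≤ f u) ∨ (∀ᶠ u in 𝓝 t, f u ≤ 0) → y = 0) →
      ∃ u, |u - t| < δ ∧ f u = y := by
  by_cases h : (∀ᶠ u in 𝓝 t, 0 ≤ f u) ∨ (∀ᶠ u in 𝓝 t, f u ≤ 0)
  · exact ⟨1, one_pos, fun y _ hy => ⟨t, by simpa, by rw [h0, hy h]⟩⟩
  · push Not at h
    obtain ⟨u, hu, hud⟩ := (h.1.and_eventually (Metric.ball_mem_nhds t hδ)).exists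
    obtain ⟨v, hv, hvd⟩ := (h.2.and_eventually (Metric.ball_mem_nhds t hδ)).exists
    refine ⟨min (-f u) (f v), lt_min (by linarith) hv, fun y hy _ => ?_⟩
    rw [abs_lt] at hy
    have h1 := min_le_left (-f u) (f v)
    have h2 := min_le_right (-f u) (f v)
    obtain ⟨x, hx, hxy⟩ := Metric.isPreconnected_ball.intermediate_value hud hvd hf.continuousOn
      ⟨show f u ≤ y by linarith, show y ≤ f v by linarith⟩
    exact ⟨x, by rwa [← Real.dist_eq], hxy⟩

/-- Values at two points of the plane are interpolated by an affine function. -/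
theorem exists_affine_interpolation {q r : Fin 6 → ℝ} (h : Fin 6 → ℝ)
    (hd : ∀ i j, i ≠ j → 0 < (q i - q j) ^ 2 + (r i - r j) ^ 2) {Z : Set (Fin 6)}
    (hZ : Z.ncard ≤ 2) : ∃ c₀ c₁ c₂ : ℝ, ∀ i ∈ Z, h i = c₀ + c₁ * q i + c₂ * r i := by
  classical
  rw [Set.ncard_eq_toFinset_card'] at hZ
  obtain ⟨S, hS, hcard⟩ := Finset.exists_superset_card_eq hZ (by simp)
  obtain ⟨i, j, hij, rfl⟩ := Finset.card_eq_two.1 hcard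
  have hpos := hd i j hij
  set d := (q i - q j) ^ 2 + (r i - r j) ^ 2 with hdd
  -- The affine function that takes the two values and is constant orthogonally to the segment
  -- joining the two points.
  refine ⟨h i - (h i - h j) * ((q i - q j) * q i + (r i - r j) * r i) / d,
    (h i - h j) * (q i - q j) / d, (h i - h j) * (r i - r j) / d, fun k hk => ?_⟩
  have hk' := hS (Set.mem_toFinset.2 hk)
  rw [Finset.mem_insert, Finset.mem_singleton] at hk'
  rcases hk' with rfl | rfl
  · field_simp; ring
  · field_simp; rw [hdd]; ring

theorem coordDet_mul_left (q r h : Fin 6 → ℝ) (c : ℝ) (i j k l : Fin 6) :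
    coordDet q r (fun i => c * h i) i j k l = c * coordDet q r h i j k l := by
  simp only [coordDet]; ring

/-- Subtracting an affine function of the base coordinates is a shear followed by a translation,
which preserves volume. -/
theorem coordDet_sub_affine (q r h : Fin 6 → ℝ) (c₀ c₁ c₂ : ℝ) (i j k l : Fin 6) :
    coordDet q r (fun i => h i - (c₀ + c₁ * q i + c₂ * r i)) i j k l = coordDet q r h i j k l := by
  simp only [coordDet]; ring

theorem IsPositivelyInterlocked.const_mul {D : Fin 6 → Fin 6 → Fin 6 → Fin 6 → ℝ}
    (h : IsPositivelyInterlocked D) {c : ℝ} (hc : 0 < c) :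
    IsPositivelyInterlocked fun i j k l => c * D i j k l := by
  obtain ⟨⟨h1, h2, h3⟩, ⟨h4, h5⟩, ⟨h6, h7⟩, h8, h9⟩ := h
  exact ⟨⟨mul_neg_of_pos_of_neg hc h1, mul_neg_of_pos_of_neg hc h2, mul_neg_of_pos_of_neg hc h3⟩,
    ⟨mul_neg_of_pos_of_neg hc h4, mul_neg_of_pos_of_neg hc h5⟩,
    ⟨mul_neg_of_pos_of_neg hc h6, mul_neg_of_pos_of_neg hc h7⟩,
    mul_neg_of_pos_of_neg hc h8, mul_neg_of_pos_of_neg hc h9⟩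

theorem IsPositivelyInterlocked.eventually {X : Type*} [TopologicalSpace X]
    {D : X → Fin 6 → Fin 6 → Fin 6 → Fin 6 → ℝ} {x : X}
    (hD : ∀ i j k l, ContinuousAt (fun x => D x i j k l) x) (h : IsPositivelyInterlocked (D x)) :
    ∀ᶠ x in 𝓝 x, IsPositivelyInterlocked (D x) := by
  obtain ⟨⟨h1, h2, h3⟩, ⟨h4, h5⟩, ⟨h6, h7⟩, h8, h9⟩ := h
  have key : ∀ i j k l, D x i j k l < 0 → ∀ᶠ x in 𝓝 x, D x i j k l < 0 := fun i j k l h =>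
    (hD i j k l).tendsto.eventually_lt_const h
  filter_upwards [key _ _ _ _ h1, key _ _ _ _ h2, key _ _ _ _ h3, key _ _ _ _ h4, key _ _ _ _ h5,
    key _ _ _ _ h6, key _ _ _ _ h7, key _ _ _ _ h8, key _ _ _ _ h9] with x
    k1 k2 k3 k4 k5 k6 k7 k8 k9
  exact ⟨⟨k1, k2, k3⟩, ⟨k4, k5⟩, ⟨k6, k7⟩, k8, k9⟩

theorem InParametricOrder.eventually {t : Fin 6 → ℝ} (ht : InParametricOrder t) :
    ∀ᶠ t' in 𝓝 t, InParametricOrder t' := by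
  have h1 : ∀ᶠ t' : Fin 6 → ℝ in 𝓝 t, ∀ i j, i < j → t' i < t' j := by
    refine eventually_all.2 fun i => eventually_all.2 fun j => ?_
    by_cases hij : i < j
    · have := ((continuous_apply i).tendsto t).eventually_lt ((continuous_apply j).tendsto t)
        (ht.1 hij)
      filter_upwards [this] with t' h _ using h
    · exact Eventually.of_forall fun _ h => (hij h).elim
  have h2 : ∀ᶠ t' : Fin 6 → ℝ in 𝓝 t, t' 5 < t' 0 + 1 :=
    ((continuous_apply 5).tendsto t).eventually_lt
      (((continuous_apply 0).add continuous_const).tendsto t) ht.2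
  filter_upwards [h1, h2] with t' k1 k2
  exact ⟨fun i j h => k1 i j h, k2⟩

/-- Orthonormal coordinates adapted to a plane with normal vector `n`. -/
theorem exists_adapted_basis {n : E3} (hn : n ≠ 0) : ∃ a b u : E3, tripleDet a b u ≠ 0 ∧
    (∀ y, y = inner ℝ a y • a + inner ℝ b y • b + inner ℝ n y • u) ∧
    (∀ y, inner ℝ n y = 0 → ‖y‖ ^ 2 = inner ℝ a y ^ 2 + inner ℝ b y ^ 2) := by
  have hn' : ‖n‖ ≠ 0 := norm_ne_zero_iff.2 hn
  have hv : Orthonormal ℝ (({2} : Set (Fin 3)).domRestrict fun _ => ‖n‖⁻¹ • n) := by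
    constructor
    · intro i
      change ‖‖n‖⁻¹ • n‖ = 1
      rw [norm_smul, norm_inv, norm_norm, inv_mul_cancel₀ hn']
    · intro i j hij
      exact (hij (Subsingleton.elim i j)).elim
  obtain ⟨e, he⟩ := hv.exists_orthonormalBasis_extension_of_card_eq (by simp)
  have he2 : e 2 = ‖n‖⁻¹ • n := he 2 rfl
  have hen : ∀ y, inner ℝ (e 2) y = ‖n‖⁻¹ * inner ℝ n y := fun y => by
    rw [he2, real_inner_smul_left]
  -- The third vector is `n / ‖n‖ ^ 2`, so that the third coordinate is `⟪n, y⟫` itself, the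
  -- function defining one-sidedness.
  refine ⟨e 0, e 1, ‖n‖⁻¹ • e 2, ?_, fun y => ?_, fun y hy => ?_⟩
  · have g : ∀ i j, e i 0 * e j 0 + e i 1 * e j 1 + e i 2 * e j 2 = if i = j then 1 else 0 := by
      intro i j
      have h := orthonormal_iff_ite.1 e.orthonormal i j
      rw [PiLp.inner_apply, Fin.sum_univ_three] at h
      simp only [RCLike.inner_apply, conj_trivial] at h
      rw [← h]; ring
    have hdet : tripleDet (e 0) (e 1) (e 2) ^ 2 = 1 := by
      have h00 := g 0 0
      have h01 := g 0 1
      have h02 := g 0 2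
      have h11 := g 1 1
      have h12 := g 1 2
      have h22 := g 2 2
      simp only [Fin.isValue, reduceIte, Fin.reduceEq] at h00 h01 h02 h11 h12 h22
      have gram : ∀ x y z : E3, tripleDet x y z ^ 2 =
          (x 0 * x 0 + x 1 * x 1 + x 2 * x 2) * ((y 0 * y 0 + y 1 * y 1 + y 2 * y 2) *
            (z 0 * z 0 + z 1 * z 1 + z 2 * z 2) - (y 0 * z 0 + y 1 * z 1 + y 2 * z 2) ^ 2) -
          (x 0 * y 0 + x 1 * y 1 + x 2 * y 2) * ((x 0 * y 0 + x 1 * y 1 + x 2 * y 2) *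
            (z 0 * z 0 + z 1 * z 1 + z 2 * z 2) - (y 0 * z 0 + y 1 * z 1 + y 2 * z 2) *
            (x 0 * z 0 + x 1 * z 1 + x 2 * z 2)) +
          (x 0 * z 0 + x 1 * z 1 + x 2 * z 2) * ((x 0 * y 0 + x 1 * y 1 + x 2 * y 2) *
            (y 0 * z 0 + y 1 * z 1 + y 2 * z 2) - (y 0 * y 0 + y 1 * y 1 + y 2 * y 2) *
            (x 0 * z 0 + x 1 * z 1 + x 2 * z 2)) := by
        intro x y z; simp only [tripleDet]; ring
      rw [gram, h00, h01, h02, h11, h12, h22]; norm_num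
    have hs : tripleDet (e 0) (e 1) (‖n‖⁻¹ • e 2) = ‖n‖⁻¹ * tripleDet (e 0) (e 1) (e 2) := by
      simp only [tripleDet, PiLp.smul_apply, smul_eq_mul]; ring
    rw [hs]
    refine mul_ne_zero (inv_ne_zero hn') fun h => ?_
    rw [h] at hdet; norm_num at hdet
  · have h := e.sum_repr' y
    rw [Fin.sum_univ_three, hen] at h
    nth_rewrite 1 [← h]
    rw [smul_smul, mul_comm (inner ℝ n y)]
  · have h := e.sum_sq_norm_inner_right y
    rw [Fin.sum_univ_three, hen, hy] at h
    simpa using h.symm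

theorem proposition2p4 (γ : ℝ → E3) (hγ : IsAnalyticKnot γ)
    (t : Fin 6 → ℝ) (ht : InParametricOrder t)
    (hM : (fun i => invStereo (γ (t i))) ∈ prismSpace)
    (n c : E3) (r : ℝ) (hn : n ≠ 0) (hC : ∀ i, OnCircle n c r (γ (t i)))
    (hone : {i | IsOneSidedAt γ n c (t i)}.ncard ≤ 2) :
    ∀ ε > 0, ∃ t' : Fin 6 → ℝ, InParametricOrder t' ∧ (∀ i, |t' i - t i| < ε) ∧
      IsRightHandedTrefoil (fun i => γ (t' i)) := by
  intro ε hε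
  have hcont : Continuous γ := continuous_iff_continuousAt.2 fun s => (hγ.analytic s).continuousAt
  obtain ⟨a, b, u, hκ, hrepr, hnorm⟩ := exists_adapted_basis hn
  set q : (Fin 6 → ℝ) → Fin 6 → ℝ := fun s i => inner ℝ a (γ (s i) - c) with hq
  set s : (Fin 6 → ℝ) → Fin 6 → ℝ := fun s i => inner ℝ b (γ (s i) - c) with hs
  have hcirc : ∀ i, q t i ^ 2 + s t i ^ 2 = r ^ 2 := by
    intro i
    rw [← (hC i).2, dist_eq_norm, hnorm _ (hC i).1]
  have hinj : Function.Injective fun i => γ (t i) := fun i j hij =>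
    hM.2.1 (congrArg invStereo hij)
  have hd : ∀ i j, i ≠ j → 0 < (q t i - q t j) ^ 2 + (s t i - s t j) ^ 2 := by
    intro i j hij
    have e : ∀ x : E3, inner ℝ x (γ (t i) - c) - inner ℝ x (γ (t j) - c) =
        inner ℝ x (γ (t i) - γ (t j)) := fun x => by
      rw [← inner_sub_right, sub_sub_sub_cancel_right]
    have h0 : inner ℝ n (γ (t i) - γ (t j)) = 0 := by
      rw [← e, (hC i).1, (hC j).1, sub_zero]
    change 0 < (inner ℝ a (γ (t i) - c) - inner ℝ a (γ (t j) - c)) ^ 2 +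
      (inner ℝ b (γ (t i) - c) - inner ℝ b (γ (t j) - c)) ^ 2
    rw [e, e, ← hnorm _ h0]
    have := sub_ne_zero.2 (hinj.ne hij)
    positivity
  obtain ⟨m, w, x, m₀, m₁, m₂, m₃, m₄, m₅, ⟨w₀, w₁, w₂⟩, x₀, x₁, x₂⟩ :=
    exists_weights_of_mem_prismSpace hM
  have coord : ∀ (e : E3) (i j : Fin 6), m i + m j = w → m i • γ (t i) + m j • γ (t j) = x →
      m i * inner ℝ e (γ (t i) - c) + m j * inner ℝ e (γ (t j) - c) =
        inner ℝ e x - w * inner ℝ e c := by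
    rintro e i j rfl rfl
    simp only [inner_sub_right, inner_add_right, real_inner_smul_right]
    ring
  obtain ⟨h, hh⟩ := exists_interlocked_heights hκ hcirc hd m₀ m₁ m₂ m₃ m₄ m₅ w₀ w₁ w₂
    (coord a 0 3 w₀ x₀) (coord a 1 4 w₁ x₁) (coord a 2 5 w₂ x₂)
    (coord b 0 3 w₀ x₀) (coord b 1 4 w₁ x₁) (coord b 2 5 w₂ x₂)
  obtain ⟨c₀, c₁, c₂, hc⟩ := exists_affine_interpolation h hd hone
  set h' : Fin 6 → ℝ := fun i => h i - (c₀ + c₁ * q t i + c₂ * s t i) with hh'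
  have hlock : IsPositivelyInterlocked fun i j k l =>
      tripleDet a b u * coordDet (q t) (s t) h' i j k l := by
    simpa only [hh', coordDet_sub_affine] using hh
  -- Only the base coordinates move with `t'`; the heights `h'` stay fixed, so `δ` can be chosen
  -- before the scale `lam`.
  have hev : ∀ᶠ t' in 𝓝 t, IsPositivelyInterlocked fun i j k l =>
      tripleDet a b u * coordDet (q t') (s t') h' i j k l := by
    refine IsPositivelyInterlocked.eventually
      (D := fun t' i j k l => tripleDet a b u * coordDet (q t') (s t') h' i j k l) ?_ hlock
    intro i j k l
    have hq' : ∀ i, Continuous fun t' => q t' i := fun i => by fun_prop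
    have hs' : ∀ i, Continuous fun t' => s t' i := fun i => by fun_prop
    simp only [coordDet]
    exact Continuous.continuousAt (by fun_prop)
  obtain ⟨δ, hδ, hball⟩ := Metric.eventually_nhds_iff.1 (hev.and ht.eventually)
  have hζ : Continuous fun z => inner ℝ n (γ z - c) := by fun_prop
  have hvalues := fun i => exists_forall_abs_lt_exists_eq hζ (lt_min hδ hε) (hC i).1
  choose η hη hvalue using hvalues
  have hsmall : ∀ᶠ lam in 𝓝[>] (0 : ℝ), ∀ i, |lam * h' i| < η i := by
    refine eventually_all.2 fun i => Filter.Eventually.filter_mono nhdsWithin_le_nhds ?_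
    have : Continuous fun lam : ℝ => |lam * h' i| := by fun_prop
    exact (this.tendsto 0).eventually_lt_const (by simpa using hη i)
  obtain ⟨lam, hlam, hlampos⟩ := (hsmall.and self_mem_nhdsWithin).exists
  have hlampos : 0 < lam := hlampos
  have hex : ∀ i, ∃ z, |z - t i| < min δ ε ∧ inner ℝ n (γ z - c) = lam * h' i := by
    intro i
    -- At a one-sided index the affine correction has made the required height zero.
    refine hvalue i _ (hlam i) fun hside => ?_
    rw [hh']
    simp only [hc i hside, sub_self, mul_zero]
  choose t' ht' hheight using hex
  obtain ⟨hlock', horder⟩ := hball (y := t') ((dist_pi_lt_iff hδ).2 fun i => by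
    rw [Real.dist_eq]; exact (ht' i).trans_le (min_le_left _ _))
  refine ⟨t', horder, fun i => (ht' i).trans_le (min_le_right _ _), ?_⟩
  refine IsPositivelyInterlocked.isRightHandedTrefoil ?_
  have hpoint : ∀ i, γ (t' i) = c + q t' i • a + s t' i • b + (lam * h' i) • u := by
    intro i
    rw [← hheight i, add_assoc, add_assoc, ← sub_eq_iff_eq_add', ← add_assoc]
    exact hrepr _
  -- The factor `lam` comes out of every determinant, so the signs survive although the hexagon is
  -- nearly planar.
  have horient : ∀ i j k l, orient (γ (t' i)) (γ (t' j)) (γ (t' k)) (γ (t' l)) =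
      lam * (tripleDet a b u * coordDet (q t') (s t') h' i j k l) := by
    intro i j k l
    rw [orient_eq_mul_coordDet (v := fun i => γ (t' i)) hpoint, coordDet_mul_left]
    ring
  simpa only [horient] using hlock'.const_mul hlampos
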